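/- Let $M$ be a finite-dimensional Hausdorff $C^\infty$ manifold without boundary (compact or not) with a symplectic form $\omega$, i.e. a $C^\infty$ closed nondegenerate $2$-form. Let $k\ge 1$ be an integer and let $f:M\to M$ be a $C^k$ symplectic diffeomorphism, i.e. a $C^k$ diffeomorphism with $f^*\omega=\omega$. Let $x\in M$ be a periodic point of $f$, with $f^n(x)=x$ for some $n\ge 1$, let $\mathcal O(x)=\{f^i(x): i\ge 0\}$ be its orbit, and let $U$ be any open neighbourhood of $\mathcal O(x)$. For an open set $A\subseteq M$, a $C^k$-neighbourhood of $f$ over $A$ is a neighbourhood of $f$ in the topology of uniform convergence, in smooth charts, of all derivatives of order at most $k$ on the compact subsets of $A$; if $M$ is compact and $A=M$ this is the usual $C^k$ topology. Then there are open sets $W,V$ with $$\mathcal O(x)\subseteq W\subseteq\overline W\subseteq V\subseteq\overline V\subseteq U,\qquad \overline V \text{ compact},$$ such that for every $C^k$-neighbourhood $\mathcal U$ of $f$ over $M$ there is a $C^k$-neighbourhood $\mathcal G$ of $f$ over $U$ with the following property: for every $g\in\mathcal G$ that is a $C^k$ local diffeomorphism on $U$ with $g^*\omega=\omega$ on $U$,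 there exists a $C^k$ symplectic diffeomorphism $h:M\to M$ in $\mathcal U$ with $$h=g \text{ on } W\qquad\text{and}\qquad h=f \text{ on } M\setminus V .$$ -/

import Mathlib

open scoped Manifold ContDiff Topology

noncomputable section

variable {E : Type*} [NormedAddCommGroup E] [NormedSpace ℝ E]
  {M : Type*} [TopologicalSpace M] [ChartedSpace E M]

/-- A (not necessarily continuous) differential two-form on `M`: an alternating bilinear form on
each tangent space. -/
abbrev TwoForm (E : Type*) [NormedAddCommGroup E] [NormedSpace ℝ E]
    (M : Type*) [TopologicalSpace M] [ChartedSpace E M] :=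
  (x : M) → TangentSpace 𝓘(ℝ, E) x [⋀^Fin 2]→L[ℝ] ℝ

/-- The expression of a two-form in a chart `φ`: the pullback `(φ⁻¹)^* Ω`, a two-form on (the
target of `φ` in) the model space `E`. -/
def TwoForm.inChart (Ω : TwoForm E M) (φ : OpenPartialHomeomorph M E) (y : E) :
    E [⋀^Fin 2]→L[ℝ] ℝ :=
  (Ω (φ.symm y)).compContinuousLinearMap (mfderiv 𝓘(ℝ, E) 𝓘(ℝ, E) φ.symm y)

/-- A symplectic form: a smooth, closed, nondegenerate two-form. -/
structure TwoForm.IsSymplectic (Ω : TwoForm E M) : Prop where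
  smooth : ∀ φ ∈ IsManifold.maximalAtlas 𝓘(ℝ, E) ∞ M, ContDiffOn ℝ ∞ (Ω.inChart φ) φ.target
  closed : ∀ φ ∈ IsManifold.maximalAtlas 𝓘(ℝ, E) ∞ M,
    ∀ y ∈ φ.target, extDeriv (Ω.inChart φ) y = 0
  nondegenerate : ∀ (x : M) (v : TangentSpace 𝓘(ℝ, E) x),
    (∀ w : TangentSpace 𝓘(ℝ, E) x, Ω x ![v, w] = 0) → v = 0

/-- `g` preserves `Ω` at all points of `U`: `g^* Ω = Ω` on `U`. -/
def PreservesOn (Ω : TwoForm E M) (g : M → M) (U : Set M) : Prop :=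
  ∀ x ∈ U, (Ω (g x)).compContinuousLinearMap (mfderiv 𝓘(ℝ, E) 𝓘(ℝ, E) g x) = Ω x

/-- The maps `g` that are `ε`-close to `f` on `K`, together with all derivatives of order at most
`k`, when read in the chart `φ` around `K` and the chart `ψ` around `f '' K`. -/
def ckBox (k : ℕ) (f : M → M) (φ ψ : OpenPartialHomeomorph M E) (K : Set M) (ε : ℝ) :
    Set (M → M) :=
  {g | Set.MapsTo g K ψ.source ∧ ∀ r ≤ k, ∀ y ∈ φ '' K,
    ‖iteratedFDeriv ℝ r (ψ ∘ g ∘ φ.symm) y - iteratedFDeriv ℝ r (ψ ∘ f ∘ φ.symm) y‖ < ε}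

/-- The filter of `C^k`-neighbourhoods of `f` over the open set `U`, for the topology of uniform
convergence of the derivatives up to order `k` on the compact subsets of `U`. It is generated by
the sets `ckBox k f φ ψ K ε`, where `φ`, `ψ` are smooth charts, `K ⊆ U` is a compact subset of the
domain of `φ` that `f` maps into the domain of `ψ`, and `ε > 0`. It is meant to be used for maps
that are `C^k` on `U`. -/
def ckNhds (E : Type*) [NormedAddCommGroup E] [NormedSpace ℝ E]
    {M : Type*} [TopologicalSpace M] [ChartedSpace E M]
    (k : ℕ) (f : M → M) (U : Set M) : Filter (M → M) :=
  Filter.generate {S | ∃ φ ∈ IsManifold.maximalAtlas 𝓘(ℝ, E) ∞ M,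
    ∃ ψ ∈ IsManifold.maximalAtlas 𝓘(ℝ, E) ∞ M, ∃ (K : Set M) (ε : ℝ),
      IsCompact K ∧ K ⊆ U ∧ K ⊆ φ.source ∧ Set.MapsTo f K ψ.source ∧ 0 < ε ∧
      S = ckBox k f φ ψ K ε}

end

/-! Passing from `g` to `f⁻¹ ∘ g` reduces the problem to symplectic maps near the orbit that are
close to the identity: if `K` is a global symplectic diffeomorphism equal to `f⁻¹ ∘ g` on `W` and to
the identity off `V`, then `h = f ∘ K` is as required. The orbit is finite, so the cut-off is made
one point at a time, in disjoint open sets (`TwoForm.IsSymplectic.exists_extension_finset`).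

Near a point, a Darboux chart makes the form a constant `J`. Cutting off a symplectic map `u`
directly destroys symplecticity; cutting off a generating function does not. In terms of the
midpoint `z = (x + u x) / 2`, the one-form `J (u x - x)` is closed because `u` is symplectic (a
Cayley transform argument), so it equals `dS`. Conversely a function `T` that is small in `C^2`
gives the symplectic map `z - J⁻¹ dT / 2 ↦ z + J⁻¹ dT / 2`. Taking `T = ρ S` with a bump function
`ρ` yields the extension (`exists_generating_function`, `exists_symplectic_of_generating_function`,
`exists_symplectic_extension`). No derivative is lost: `S` is one order smoother than `u`, and `dT`
is again of class `C^k`.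

Darboux charts of class `C^k` come from Moser's method (`exists_darboux_map`). The flow is obtained
from the inverse function theorem in a space of curves.

Estimates are expressed as convergence along a filter (`CkConv` in vector spaces, `MConv` on
manifolds), stable under composition and, near the identity, under inversion. The final filter is
that of the `C^k`-neighbourhoods of `f` over `U`, restricted to the admissible `g`. Thus `W`, `V`
and `g ↦ K g` are fixed before `𝒰`, and `𝒢` is read off from the convergence of `f ∘ K g` to `f`. -/

section

open Filter Metric

/-! ### Calculus of `C^k` convergence in normed spaces. -/

section CkConvergence

variable {ι X Y Z : Type*}
  [NormedAddCommGroup X] [NormedSpace ℝ X] [NormedAddCommGroup Y] [NormedSpace ℝ Y]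
  [NormedAddCommGroup Z] [NormedSpace ℝ Z] {k : ℕ} {l : Filter ι}

/-- A locally uniform eventual property holds eventually uniformly on compact sets. -/
theorem IsCompact.eventually_forall_of_prod_nhds {A : Type*} [TopologicalSpace A] {K : Set A}
    (hK : IsCompact K) {P : ι → A → Prop}
    (h : ∀ x ∈ K, ∀ᶠ p in l ×ˢ 𝓝 x, P p.1 p.2) : ∀ᶠ i in l, ∀ x ∈ K, P i x := by
  refine hK.induction_on (p := fun s => ∀ᶠ i in l, ∀ x ∈ s, P i x) (by simp)
    (fun s t hst ht => ht.mono fun i hi x hx => hi x (hst hx))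
    (fun s t hs ht => ?_) fun x hx => ?_
  · filter_upwards [hs, ht] with i h1 h2 x hx
    exact hx.elim (h1 x) (h2 x)
  · obtain ⟨pa, ha, pb, hb, hab⟩ := eventually_prod_iff.1 (h x hx)
    exact ⟨{y | pb y}, mem_nhdsWithin_of_mem_nhds hb, ha.mono fun i hi y hy => hab hi hy⟩

/-- Passes from values to germs, so that identities holding jointly near a point can be
differentiated. -/
theorem Filter.Eventually.prod_nhds_eventually_nhds {A : Type*} [TopologicalSpace A] {x : A}
    {P : ι → A → Prop} (h : ∀ᶠ p in l ×ˢ 𝓝 x, P p.1 p.2) :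
    ∀ᶠ p in l ×ˢ 𝓝 x, ∀ᶠ y in 𝓝 p.2, P p.1 y := by
  obtain ⟨pa, ha, pb, hb, hab⟩ := eventually_prod_iff.1 h
  exact eventually_prod_iff.2 ⟨pa, ha, _, hb.eventually_nhds, fun hi _ hy => hy.mono fun z hz =>
    hab hi hz⟩

/-- The maps `F i` converge along `l` to `f`, uniformly near `x` in the `C^k` sense. -/
structure CkConv (k : ℕ) (l : Filter ι) (F : ι → X → Y) (f : X → Y) (x : X) : Prop where
  limit : ContDiffAt ℝ k f x
  eventually : ∀ᶠ p in l ×ˢ 𝓝 x, ContDiffAt ℝ k (F p.1) p.2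
  tendsto_iteratedFDeriv : ∀ r ≤ k, Tendsto (fun p : ι × X => iteratedFDeriv ℝ r (F p.1) p.2)
    (l ×ˢ 𝓝 x) (𝓝 (iteratedFDeriv ℝ r f x))

theorem tendsto_iteratedFDeriv_zero_iff {F : ι → X → Y} {f : X → Y} {x : X} :
    Tendsto (fun p : ι × X => iteratedFDeriv ℝ 0 (F p.1) p.2) (l ×ˢ 𝓝 x)
      (𝓝 (iteratedFDeriv ℝ 0 f x)) ↔
    Tendsto (fun p : ι × X => F p.1 p.2) (l ×ˢ 𝓝 x) (𝓝 (f x)) := by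
  simp only [iteratedFDeriv_zero_eq_comp]
  exact (continuousMultilinearCurryFin0 ℝ X Y).symm.toHomeomorph.isInducing.tendsto_nhds_iff.symm

/-- Currying is a linear isometry, hence inducing. Through `CkConv.fderiv` and
`CkConv.of_hasFDerivAt` this drives the induction on the order of differentiability. -/
theorem tendsto_iteratedFDeriv_succ_iff {F : ι → X → Y} {f : X → Y} {x : X} {r : ℕ} :
    Tendsto (fun p : ι × X => iteratedFDeriv ℝ (r + 1) (F p.1) p.2) (l ×ˢ 𝓝 x)
      (𝓝 (iteratedFDeriv ℝ (r + 1) f x)) ↔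
    Tendsto (fun p : ι × X => iteratedFDeriv ℝ r (fderiv ℝ (F p.1)) p.2) (l ×ˢ 𝓝 x)
      (𝓝 (iteratedFDeriv ℝ r (fderiv ℝ f) x)) := by
  simp only [iteratedFDeriv_succ_eq_comp_right]
  exact (continuousMultilinearCurryRightEquiv' ℝ r X
    Y).symm.toHomeomorph.isInducing.tendsto_nhds_iff.symm

namespace CkConv

theorem tendsto {F : ι → X → Y} {f : X → Y} {x : X} (h : CkConv k l F f x) :
    Tendsto (fun p : ι × X => F p.1 p.2) (l ×ˢ 𝓝 x) (𝓝 (f x)) :=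
  tendsto_iteratedFDeriv_zero_iff.1 (h.tendsto_iteratedFDeriv 0 (Nat.zero_le _))

theorem mono {F : ι → X → Y} {f : X → Y} {x : X} {j : ℕ} (h : CkConv k l F f x) (hj : j ≤ k) :
    CkConv j l F f x :=
  ⟨h.limit.of_le (by exact_mod_cast hj), h.eventually.mono fun _ hp => hp.of_le (by exact_mod_cast hj),
    fun r hr => h.tendsto_iteratedFDeriv r (hr.trans hj)⟩

theorem const {f : X → Y} {x : X} (h : ContDiffAt ℝ k f x) : CkConv k l (fun _ => f) f x := by
  refine ⟨h, ?_, fun r hr => ?_⟩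
  · exact (h.eventually (by simp)).prod_inr l
  · have : ContinuousAt (iteratedFDeriv ℝ r f) x :=
      (h.iteratedFDeriv_right (m := 0) (by simpa using hr)).continuousAt
    exact this.tendsto.comp tendsto_snd

theorem congr {F F' : ι → X → Y} {f f' : X → Y} {x : X} (h : CkConv k l F f x)
    (hF : ∀ᶠ p in l ×ˢ 𝓝 x, F p.1 p.2 = F' p.1 p.2) (hf : f =ᶠ[𝓝 x] f') :
    CkConv k l F' f' x := by
  have hF' : ∀ᶠ p in l ×ˢ 𝓝 x, F p.1 =ᶠ[𝓝 p.2] F' p.1 :=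
    Filter.Eventually.prod_nhds_eventually_nhds (P := fun i y => F i y = F' i y) hF
  refine ⟨h.limit.congr_of_eventuallyEq hf.symm, ?_, fun r hr => ?_⟩
  · filter_upwards [h.eventually, hF'] with p h1 h2
    exact h1.congr_of_eventuallyEq h2.symm
  · rw [← (hf.iteratedFDeriv ℝ r).self_of_nhds]
    refine (h.tendsto_iteratedFDeriv r hr).congr' ?_
    filter_upwards [hF'] with p h2
    exact (h2.iteratedFDeriv ℝ r).self_of_nhds

/-- By Faà di Bruno's formula, a derivative of the composite is a finite sum of continuous
expressions in derivatives of the factors of no higher order. Sums, scalar multiples and images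
under fixed maps are special cases. -/
theorem comp {G : ι → Y → Z} {g : Y → Z} {F : ι → X → Y} {f : X → Y} {x : X}
    (hG : CkConv k l G g (f x)) (hF : CkConv k l F f x) :
    CkConv k l (fun i => G i ∘ F i) (g ∘ f) x := by
  have hT : Tendsto (fun p : ι × X => (p.1, F p.1 p.2)) (l ×ˢ 𝓝 x) (l ×ˢ 𝓝 (f x)) :=
    tendsto_fst.prodMk hF.tendsto
  have hev : ∀ᶠ p in l ×ˢ 𝓝 x, ContDiffAt ℝ k (G p.1) (F p.1 p.2) := hT.eventually hG.eventually
  refine ⟨hG.limit.comp x hF.limit, ?_, fun r hr => ?_⟩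
  · filter_upwards [hF.eventually, hev] with p h1 h2
    exact h2.comp p.2 h1
  · rw [iteratedFDeriv_comp hG.limit hF.limit (by exact_mod_cast hr)]
    have : Tendsto (fun p : ι × X => (ftaylorSeries ℝ (G p.1) (F p.1 p.2)).taylorComp
        (ftaylorSeries ℝ (F p.1) p.2) r) (l ×ˢ 𝓝 x)
        (𝓝 ((ftaylorSeries ℝ g (f x)).taylorComp (ftaylorSeries ℝ f x) r)) := by
      unfold FormalMultilinearSeries.taylorComp
      refine tendsto_finsetSum _ fun c _ => ?_
      have h1 : Tendsto (fun p : ι × X => ftaylorSeries ℝ (G p.1) (F p.1 p.2) c.length)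
          (l ×ˢ 𝓝 x) (𝓝 (ftaylorSeries ℝ g (f x) c.length)) :=
        (hG.tendsto_iteratedFDeriv _ (c.length_le.trans hr)).comp hT
      have h2 : Tendsto (fun p : ι × X => fun m : Fin c.length =>
          ftaylorSeries ℝ (F p.1) p.2 (c.partSize m))
          (l ×ˢ 𝓝 x) (𝓝 (fun m => ftaylorSeries ℝ f x (c.partSize m))) :=
        tendsto_pi_nhds.2 fun m => hF.tendsto_iteratedFDeriv _ ((c.partSize_le m).trans hr)
      have h3 : Continuous (fun q : (Y [×c.length]→L[ℝ] Z) ×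
          (∀ m : Fin c.length, X [×c.partSize m]→L[ℝ] Y) =>
          c.compAlongOrderedFinpartitionL ℝ X Y Z q.1 q.2) := by
        exact ((c.compAlongOrderedFinpartitionL ℝ X Y Z).continuous.comp
          continuous_fst).eval continuous_snd
      exact (h3.tendsto _).comp (h1.prodMk_nhds h2)
    refine this.congr' ?_
    filter_upwards [hF.eventually, hev] with p h1 h2
    exact (iteratedFDeriv_comp h2 h1 (by exact_mod_cast hr)).symm

theorem prodMk {F : ι → X → Y} {f : X → Y} {G : ι → X → Z} {g : X → Z} {x : X}
    (hF : CkConv k l F f x) (hG : CkConv k l G g x) :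
    CkConv k l (fun i y => (F i y, G i y)) (fun y => (f y, g y)) x := by
  refine ⟨hF.limit.prodMk hG.limit, ?_, fun r hr => ?_⟩
  · filter_upwards [hF.eventually, hG.eventually] with p h1 h2 using h1.prodMk h2
  · rw [iteratedFDeriv_prodMk hF.limit hG.limit (by exact_mod_cast hr)]
    have h3 : Continuous (fun q : (X [×r]→L[ℝ] Y) × (X [×r]→L[ℝ] Z) => q.1.prod q.2) :=
      (ContinuousMultilinearMap.prodL ℝ (fun _ : Fin r => X) Y Z).continuous
    refine ((h3.tendsto _).comp ((hF.tendsto_iteratedFDeriv r hr).prodMk_nhds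
      (hG.tendsto_iteratedFDeriv r hr))).congr' ?_
    filter_upwards [hF.eventually, hG.eventually] with p h1 h2
    exact (iteratedFDeriv_prodMk h1 h2 (by exact_mod_cast hr)).symm

/-- Composition with a fixed map of class `C^k` preserves convergence. -/
theorem comp_left {g : Y → Z} {F : ι → X → Y} {f : X → Y} {x : X} (hF : CkConv k l F f x)
    (hg : ContDiffAt ℝ k g (f x)) : CkConv k l (fun i y => g (F i y)) (fun y => g (f y)) x :=
  (CkConv.const hg).comp hF

theorem comp_left₂ {W : Type*} [NormedAddCommGroup W] [NormedSpace ℝ W] {g : Y × Z → W}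
    {F : ι → X → Y} {f : X → Y} {G : ι → X → Z} {h : X → Z} {x : X}
    (hF : CkConv k l F f x) (hG : CkConv k l G h x) (hg : ContDiffAt ℝ k g (f x, h x)) :
    CkConv k l (fun i y => g (F i y, G i y)) (fun y => g (f y, h y)) x :=
  (hF.prodMk hG).comp_left hg

theorem add {F G : ι → X → Y} {f g : X → Y} {x : X} (hF : CkConv k l F f x)
    (hG : CkConv k l G g x) : CkConv k l (fun i y => F i y + G i y) (fun y => f y + g y) x :=
  hF.comp_left₂ (g := fun q : Y × Y => q.1 + q.2) hG (by fun_prop)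

theorem sub {F G : ι → X → Y} {f g : X → Y} {x : X} (hF : CkConv k l F f x)
    (hG : CkConv k l G g x) : CkConv k l (fun i y => F i y - G i y) (fun y => f y - g y) x :=
  hF.comp_left₂ (g := fun q : Y × Y => q.1 - q.2) hG (by fun_prop)

theorem clm {F : ι → X → Y} {f : X → Y} {x : X} (hF : CkConv k l F f x) (L : Y →L[ℝ] Z) :
    CkConv k l (fun i y => L (F i y)) (fun y => L (f y)) x :=
  hF.comp_left L.contDiff.contDiffAt

theorem smul {F : ι → X → ℝ} {f : X → ℝ} {G : ι → X → Y} {g : X → Y} {x : X}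
    (hF : CkConv k l F f x) (hG : CkConv k l G g x) :
    CkConv k l (fun i y => F i y • G i y) (fun y => f y • g y) x :=
  hF.comp_left₂ (g := fun q : ℝ × Y => q.1 • q.2) hG (by fun_prop)

theorem fderiv {F : ι → X → Y} {f : X → Y} {x : X} (h : CkConv (k + 1) l F f x) :
    CkConv k l (fun i => fderiv ℝ (F i)) (fderiv ℝ f) x := by
  refine ⟨h.limit.fderiv_right (by simp), ?_, fun r hr => ?_⟩
  · filter_upwards [h.eventually] with p hp using hp.fderiv_right (by simp)
  · exact tendsto_iteratedFDeriv_succ_iff.1 (h.tendsto_iteratedFDeriv (r + 1) (by omega))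

/-- Gains one order of convergence. It serves for inverse maps and for generating functions, where
the differential is what is controlled. -/
theorem of_hasFDerivAt {F : ι → X → Y} {f : X → Y} {F' : ι → X → X →L[ℝ] Y}
    {f' : X → X →L[ℝ] Y} {x : X}
    (hF : ∀ᶠ p in l ×ˢ 𝓝 x, HasFDerivAt (F p.1) (F' p.1 p.2) p.2)
    (hf : ∀ᶠ y in 𝓝 x, HasFDerivAt f (f' y) y)
    (h0 : Tendsto (fun p : ι × X => F p.1 p.2) (l ×ˢ 𝓝 x) (𝓝 (f x)))
    (h : CkConv k l F' f' x) : CkConv (k + 1) l F f x := by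
  have hF2 := Filter.Eventually.prod_nhds_eventually_nhds
    (P := fun i y => HasFDerivAt (F i) (F' i y) y) hF
  have h2 : CkConv k l (fun i => _root_.fderiv ℝ (F i)) (_root_.fderiv ℝ f) x :=
    h.congr (hF.mono fun p hp => hp.fderiv.symm) (hf.mono fun y hy => hy.fderiv.symm)
  refine ⟨?_, ?_, fun r hr => ?_⟩
  · exact_mod_cast contDiffAt_succ_iff_hasFDerivAt.2 ⟨f', ⟨_, hf, fun _ h => h⟩, h.limit⟩
  · filter_upwards [hF2, h.eventually] with p hp hp2
    exact_mod_cast contDiffAt_succ_iff_hasFDerivAt.2 ⟨F' p.1, ⟨_, hp, fun _ h => h⟩, hp2⟩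
  · cases r with
    | zero => exact tendsto_iteratedFDeriv_zero_iff.2 h0
    | succ r => exact tendsto_iteratedFDeriv_succ_iff.2 (h2.tendsto_iteratedFDeriv r (by omega))

theorem zero_iff {F : ι → X → Y} {f : X → Y} {x : X} :
    CkConv 0 l F f x ↔ ContDiffAt ℝ (0 : ℕ) f x ∧
      (∀ᶠ p in l ×ˢ 𝓝 x, ContDiffAt ℝ (0 : ℕ) (F p.1) p.2) ∧
      Tendsto (fun p : ι × X => F p.1 p.2) (l ×ˢ 𝓝 x) (𝓝 (f x)) :=
  ⟨fun h => ⟨h.limit, h.eventually, h.tendsto⟩, fun h => ⟨h.1, h.2.1, fun r hr => by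
    obtain rfl := Nat.le_zero.1 hr
    exact tendsto_iteratedFDeriv_zero_iff.2 h.2.2⟩⟩

/-- Convergence of the inverses: if `N i` is a right inverse of `F i` near `x`, continuous
together with its limit, then `C^k` convergence of the `F i` gives that of the `N i`. -/
theorem rightInverse [CompleteSpace X] {F : ι → X → X} {f : X → X} {N : ι → X → X} {n : X → X} {x : X}
    (hk : 1 ≤ k)
    (hF : CkConv k l F f (n x)) (hf : (_root_.fderiv ℝ f (n x)).IsInvertible)
    (hn : ∀ᶠ y in 𝓝 x, HasFDerivAt n (_root_.fderiv ℝ f (n y)).inverse y)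
    (hN : ∀ᶠ p in l ×ˢ 𝓝 x, HasFDerivAt (N p.1) (_root_.fderiv ℝ (F p.1) (N p.1 p.2)).inverse p.2)
    (h0 : Tendsto (fun p : ι × X => N p.1 p.2) (l ×ˢ 𝓝 x) (𝓝 (n x))) :
    CkConv k l N n x := by
  -- Bootstrap: the derivative of `N i` is the inverse of `fderiv ℝ (F i)` along `N i`, so `C^j`
  -- convergence of `N` gives `C^j` convergence of its derivative as long as `j < k`.
  have key : ∀ j ≤ k, CkConv j l N n x := by
    intro j
    induction j with
    | zero =>
      intro _
      refine zero_iff.2 ⟨?_, ?_, h0⟩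
      · exact contDiffAt_zero.2 ⟨_, hn, fun y hy => hy.continuousAt.continuousWithinAt⟩
      · filter_upwards [Filter.Eventually.prod_nhds_eventually_nhds
          (P := fun i y => HasFDerivAt (N i) (_root_.fderiv ℝ (F i) (N i y)).inverse y) hN] with p hp
        exact contDiffAt_zero.2 ⟨_, hp, fun y hy => hy.continuousAt.continuousWithinAt⟩
    | succ j ih =>
      intro hj
      have h1 := ih (by omega)
      obtain ⟨m, rfl⟩ : ∃ m, k = m + 1 := ⟨k - 1, by omega⟩
      have h2 := (hF.fderiv.mono (j := j) (by omega)).comp h1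
      have h3 := h2.comp_left (g := ContinuousLinearMap.inverse) (by
        obtain ⟨e, he⟩ := hf
        simp only [Function.comp, ← he]
        exact contDiffAt_map_inverse e)
      exact of_hasFDerivAt hN hn h0 h3
  exact key k le_rfl

end CkConv

end CkConvergence

/-! ### Perturbations of the identity and their inverses. -/

section NearIdentity

variable {ι X Y : Type*}
  [NormedAddCommGroup X] [NormedSpace ℝ X] [NormedAddCommGroup Y] [NormedSpace ℝ Y]
  {k : ℕ} {l : Filter ι}

namespace CkConv

theorem eventually_contDiffAt_of_isCompact {F : ι → X → Y} {f : X → Y} {K : Set X}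
    (hK : IsCompact K) (h : ∀ x ∈ K, CkConv k l F f x) :
    ∀ᶠ i in l, ∀ x ∈ K, ContDiffAt ℝ k (F i) x :=
  hK.eventually_forall_of_prod_nhds (P := fun i x => ContDiffAt ℝ k (F i) x)
    fun x hx => (h x hx).eventually

theorem eventually_norm_lt_of_isCompact {F : ι → X → Y} {K : Set X}
    (hK : IsCompact K) (h : ∀ x ∈ K, CkConv k l F (fun _ => 0) x) {ε : ℝ} (hε : 0 < ε) :
    ∀ᶠ i in l, ∀ x ∈ K, ‖F i x‖ < ε :=
  hK.eventually_forall_of_prod_nhds (P := fun i x => ‖F i x‖ < ε) fun x hx => by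
    have := (h x hx).tendsto.norm
    rw [norm_zero] at this
    exact this.eventually (gt_mem_nhds hε)

theorem eventually_norm_fderiv_lt_of_isCompact {F : ι → X → Y} {K : Set X}
    (hK : IsCompact K) (hk : 1 ≤ k) (h : ∀ x ∈ K, CkConv k l F (fun _ => 0) x)
    {ε : ℝ} (hε : 0 < ε) :
    ∀ᶠ i in l, ∀ x ∈ K, ‖_root_.fderiv ℝ (F i) x‖ < ε := by
  refine eventually_norm_lt_of_isCompact (k := 0) (F := fun i => _root_.fderiv ℝ (F i)) hK
    (fun x hx => ?_) hε
  have := ((h x hx).mono (j := 0 + 1) hk).fderiv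
  simpa using! this

/-- Maps vanishing outside a fixed closed set converge to zero as soon as they do so on it. -/
theorem zero_of_support {F : ι → X → Y} {K : Set X} (hK : IsClosed K)
    (h0 : ∀ i, ∀ x ∉ K, F i x = 0) (h : ∀ x ∈ K, CkConv k l F (fun _ => 0) x) (x : X) :
    CkConv k l F (fun _ => 0) x := by
  by_cases hx : x ∈ K
  · exact h x hx
  · refine (CkConv.const (f := fun _ : X => (0 : Y)) contDiffAt_const).congr ?_ EventuallyEq.rfl
    have : ∀ᶠ y in 𝓝 x, y ∉ K := hK.isOpen_compl.mem_nhds hx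
    exact (this.prod_inr l).mono fun p hp => (h0 p.1 p.2 hp).symm

end CkConv

theorem Function.LeftInverse.hasFDerivAt_inverse {f g : X → X} {y : X}
    (hl : Function.LeftInverse g f) (hr : Function.RightInverse g f)
    (hf : DifferentiableAt ℝ f (g y)) (hg : DifferentiableAt ℝ g y) :
    HasFDerivAt g (fderiv ℝ f (g y)).inverse y := by
  have h1 : (fderiv ℝ f (g y)).comp (fderiv ℝ g y) = ContinuousLinearMap.id ℝ X := by
    rw [← fderiv_comp y hf hg, hr.comp_eq_id, fderiv_id]
  have hg' : DifferentiableAt ℝ g (f (g y)) := by rwa [hr y]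
  have h2 : (fderiv ℝ g y).comp (fderiv ℝ f (g y)) = ContinuousLinearMap.id ℝ X := by
    have := fderiv_comp (g y) hg' hf
    rw [hl.comp_eq_id, fderiv_id, hr y] at this
    exact this.symm
  rw [ContinuousLinearMap.inverse_eq h1 h2]
  exact hg.hasFDerivAt

/-- A contractive perturbation of the identity is invertible. -/
theorem exists_inverse_of_norm_fderiv_le [CompleteSpace X] (hk : 1 ≤ k) {w : X → X}
    (hw : ContDiff ℝ k w) (hb : ∀ x, ‖fderiv ℝ w x‖ ≤ 1 / 2) :
    ∃ n : X → X, Function.LeftInverse n (fun x => x + w x) ∧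
      Function.RightInverse n (fun x => x + w x) ∧ ContDiff ℝ k n := by
  have hd : Differentiable ℝ w := hw.differentiable (by simp; omega)
  have hlip : LipschitzWith (1 / 2 : NNReal) w :=
    lipschitzWith_of_nnnorm_fderiv_le hd fun x => by
      rw [← NNReal.coe_le_coe]; simpa using hb x
  have happ : ApproximatesLinearOn (fun x => x + w x)
      ((ContinuousLinearEquiv.refl ℝ X : X ≃L[ℝ] X) : X →L[ℝ] X) Set.univ (1 / 2 : NNReal) := by
    rw [ApproximatesLinearOn.approximatesLinearOn_iff_lipschitzOnWith]
    convert hlip.lipschitzOnWith using 1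
    ext x; simp
  -- On the zero space the identity has norm zero and the numerical bound fails.
  have hc : Subsingleton X ∨ (1 / 2 : NNReal) <
      ‖(((ContinuousLinearEquiv.refl ℝ X).symm : X ≃L[ℝ] X) : X →L[ℝ] X)‖₊⁻¹ := by
    rcases subsingleton_or_nontrivial X with h | h
    · exact Or.inl h
    · right
      have : ‖(((ContinuousLinearEquiv.refl ℝ X).symm : X ≃L[ℝ] X) : X →L[ℝ] X)‖₊ = 1 := by
        ext; simp
      rw [this, inv_one, ← NNReal.coe_lt_coe]; norm_num
  let Φ := happ.toHomeomorph _ hc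
  have hΦ : ∀ x, Φ x = x + w x := fun x => rfl
  refine ⟨Φ.symm, fun x => Φ.symm_apply_apply x, fun x => Φ.apply_symm_apply x, ?_⟩
  have hu : ∀ x, ‖-fderiv ℝ w x‖ < 1 := fun x => by
    rw [norm_neg]; exact (hb x).trans_lt (by norm_num)
  refine Φ.contDiff_symm (f₀' := fun x => ContinuousLinearEquiv.unitsEquiv ℝ X
    (Units.oneSub _ (hu x))) (fun x => ?_) (contDiff_id.add hw)
  have h1 : HasFDerivAt (fun x => x + w x) (ContinuousLinearMap.id ℝ X + fderiv ℝ w x) x :=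
    (hasFDerivAt_id x).add (hd x).hasFDerivAt
  refine HasFDerivAt.congr_fderiv h1 ?_
  ext v
  simp

/-- Perturbations of the identity that converge to it and are supported in a fixed compact set
are eventually diffeomorphisms, and their inverses converge to the identity. -/
theorem CkConv.exists_inverse_of_support [CompleteSpace X] (hk : 1 ≤ k) {w : ι → X → X}
    {K : Set X} (hK : IsCompact K) (h0 : ∀ i, ∀ x ∉ K, w i x = 0)
    (h : ∀ x, CkConv k l w (fun _ => 0) x) :
    ∃ n : ι → X → X, (∀ x, CkConv k l n id x) ∧ ∀ᶠ i in l, ContDiff ℝ k (w i) ∧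
      Function.LeftInverse (n i) (fun x => x + w i x) ∧
      Function.RightInverse (n i) (fun x => x + w i x) ∧ ContDiff ℝ k (n i) := by
  have hz : ∀ i, ∀ x ∉ K, w i =ᶠ[𝓝 x] fun _ => 0 := fun i x hx => by
    filter_upwards [hK.isClosed.isOpen_compl.mem_nhds hx] with y hy using h0 i y hy
  have hcd : ∀ᶠ i in l, ContDiff ℝ k (w i) := by
    filter_upwards [eventually_contDiffAt_of_isCompact hK fun x _ => h x] with i hi
    refine contDiff_iff_contDiffAt.2 fun x => ?_
    by_cases hx : x ∈ K
    · exact hi x hx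
    · exact contDiffAt_const.congr_of_eventuallyEq (hz i x hx)
  have hb : ∀ᶠ i in l, ∀ x, ‖_root_.fderiv ℝ (w i) x‖ ≤ 1 / 2 := by
    filter_upwards [eventually_norm_fderiv_lt_of_isCompact hK hk (fun x _ => h x)
      (ε := 1 / 2) (by norm_num)] with i hi x
    by_cases hx : x ∈ K
    · exact (hi x hx).le
    · rw [(hz i x hx).fderiv_eq]; simp
  have hs : ∀ ε > 0, ∀ᶠ i in l, ∀ x, ‖w i x‖ < ε := fun ε hε => by
    filter_upwards [eventually_norm_lt_of_isCompact hK (fun x _ => h x) hε] with i hi x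
    by_cases hx : x ∈ K
    · exact hi x hx
    · rw [h0 i x hx]; simpa
  have hex : ∀ᶠ i in l, ∃ n : X → X, ContDiff ℝ k (w i) ∧
      Function.LeftInverse n (fun x => x + w i x) ∧
      Function.RightInverse n (fun x => x + w i x) ∧ ContDiff ℝ k n := by
    filter_upwards [hcd, hb] with i h1 h2
    obtain ⟨n, hn⟩ := exists_inverse_of_norm_fderiv_le hk h1 h2
    exact ⟨n, h1, hn⟩
  -- The inverses exist only eventually; the family is arbitrary at the other indices.
  obtain ⟨n, hn⟩ := skolem.1 hex
  refine ⟨n, fun x => ?_, hn⟩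
  have hk0 : (k : ℕ∞ω) ≠ 0 := by simp; omega
  have hid : _root_.fderiv ℝ (fun x : X => x + (0 : X)) = fun _ => ContinuousLinearMap.id ℝ X := by
    ext x : 1; simp
  have hF : ∀ x, CkConv k l (fun i x => x + w i x) (fun x => x + (0 : X)) x := fun x =>
    (CkConv.const (f := fun x : X => x) contDiffAt_id).add (h x)
  refine CkConv.rightInverse (F := fun i x => x + w i x) (f := fun x => x + 0) (n := id) hk
    (hF _) ?_ (Eventually.of_forall fun y => ?_) ?_ ?_
  · rw [hid]; exact ⟨ContinuousLinearEquiv.refl ℝ X, rfl⟩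
  · rw [hid, ContinuousLinearMap.inverse_id]; exact hasFDerivAt_id y
  · refine (hn.prod_inl (𝓝 x)).mono fun p hp => ?_
    exact hp.2.1.hasFDerivAt_inverse hp.2.2.1
      (differentiableAt_id.add (hp.1.differentiable hk0 _)) (hp.2.2.2.differentiable hk0 _)
  -- Since `y - n y = w (n y)`, uniform smallness of `w` gives uniform convergence of the inverses.
  · have h3 : Tendsto (fun p : ι × X => n p.1 p.2 - p.2) (l ×ˢ 𝓝 x) (𝓝 0) := by
      rw [Metric.tendsto_nhds]
      intro ε hε
      refine ((hn.and (hs ε hε)).prod_inl (𝓝 x)).mono fun p hp => ?_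
      have h4 := hp.1.2.2.1 p.2
      simp only at h4
      rw [dist_zero_right, ← norm_neg, neg_sub]
      have h5 : p.2 - n p.1 p.2 = w p.1 (n p.1 p.2) := by
        rw [sub_eq_iff_eq_add']; exact h4.symm
      rw [h5]; exact hp.2 _
    simpa using h3.add tendsto_snd

end NearIdentity

/-! ### Generating functions of symplectic maps near the identity. -/

section LocalExtension

variable {ι E : Type*} [NormedAddCommGroup E] [NormedSpace ℝ E]
  {k : ℕ} {l : Filter ι}

/-- The Cayley transform of an infinitesimally symplectic map is symplectic. -/
theorem cayley_symplectic {J : E →L[ℝ] E →L[ℝ] ℝ} (hJ : ∀ a b, J a b = -J b a) {A : E →L[ℝ] E}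
    (hA : ∀ a b, J (A a) b = J (A b) a) (p q : E) :
    J (p + (1 / 2 : ℝ) • A p) (q + (1 / 2 : ℝ) • A q) =
      J (p - (1 / 2 : ℝ) • A p) (q - (1 / 2 : ℝ) • A q) := by
  simp only [map_add, map_sub, map_smul, add_apply, sub_apply, smul_apply, smul_eq_mul]
  have h1 := hA p q
  have h2 := hJ p (A q)
  linarith

/-- On expanding, `J p q` and the term quadratic in `A` cancel, leaving the symmetry. When `A` is
the derivative of the displacement as a function of the midpoint, this is the closedness of the
generating one-form. -/
theorem symm_of_cayley_symplectic {J : E →L[ℝ] E →L[ℝ] ℝ} (hJ : ∀ a b, J a b = -J b a)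
    {A : E →L[ℝ] E} {p q : E}
    (h : J (p + (1 / 2 : ℝ) • A p) (q + (1 / 2 : ℝ) • A q) =
      J (p - (1 / 2 : ℝ) • A p) (q - (1 / 2 : ℝ) • A q)) :
    J (A p) q = J (A q) p := by
  simp only [map_add, map_sub, map_smul, add_apply, sub_apply, smul_apply, smul_eq_mul] at h
  have h2 := hJ p (A q)
  linarith

/-- Symplectic maps of a ball converging to the identity admit generating functions, with respect
to the midpoint correspondence, which converge to zero. -/
theorem exists_generating_function [FiniteDimensional ℝ E] (J : E ≃L[ℝ] (E →L[ℝ] ℝ)) (hJ : ∀ a b, J a b = -J b a)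
    (hk : 1 ≤ k) {c : E} {R : ℝ} (hR : 0 < R) {u : ι → E → E}
    (hu : ∀ x ∈ ball c R, CkConv k l u id x)
    (hs : ∀ᶠ i in l, ∀ x ∈ ball c R, ∀ a b,
      J (fderiv ℝ (u i) x a) (fderiv ℝ (u i) x b) = J a b) :
    ∃ S : ι → E → ℝ, (∀ z ∈ ball c (R / 4), CkConv (k + 1) l S (fun _ => 0) z) ∧
      ∀ᶠ i in l, ∀ x ∈ ball c (R / 16), x + (1 / 2 : ℝ) • (u i x - x) ∈ ball c (R / 8) ∧
        HasFDerivAt (S i) (J (u i x - x)) (x + (1 / 2 : ℝ) • (u i x - x)) := by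
  have hk0 : (k : ℕ∞ω) ≠ 0 := by simp; omega
  -- With the cut-off, `x + w x` is a global perturbation of the identity and can be inverted; on
  -- the closed ball of radius `R / 2` it is the true midpoint map.
  let χ : ContDiffBump c := ⟨R / 2, 3 * R / 4, by linarith, by linarith⟩
  let w : ι → E → E := fun i x => (χ x * (1 / 2)) • (u i x - x)
  have hχ1 : ∀ x ∈ closedBall c (R / 2), χ x = 1 := fun x hx => χ.one_of_mem_closedBall hx
  have hw1 : ∀ i, ∀ x ∈ closedBall c (R / 2), w i x = (1 / 2 : ℝ) • (u i x - x) := fun i x hx => by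
    simp [w, hχ1 x hx]
  have hdiff : ∀ x ∈ ball c R, CkConv k l (fun i x => u i x - x) (fun _ => 0) x := fun x hx =>
    ((hu x hx).sub (CkConv.const (f := fun x => x) contDiffAt_id)).congr
      (Eventually.of_forall fun _ => rfl) (Eventually.of_forall fun y => by simp)
  have hw : ∀ x, CkConv k l w (fun _ => 0) x := by
    refine CkConv.zero_of_support (K := closedBall c (3 * R / 4)) isClosed_closedBall
      (fun i x hx => ?_) fun x hx => ?_
    · have : χ x = 0 := χ.zero_of_le_dist (le_of_lt (by simpa using hx))
      simp [w, this]
    · have hx' : x ∈ ball c R := closedBall_subset_ball (by linarith) hx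
      refine ((CkConv.const (k := k) (l := l) (f := fun x => χ x * (1 / 2)) (x := x)
        ?_).smul (hdiff x hx')).congr (Eventually.of_forall fun _ => rfl)
        (Eventually.of_forall fun y => by simp)
      exact χ.contDiffAt.mul contDiffAt_const
  obtain ⟨n, hn, hni⟩ := CkConv.exists_inverse_of_support hk
    (isCompact_closedBall c (3 * R / 4)) (w := w) (fun i x hx => by
      have : χ x = 0 := χ.zero_of_le_dist (le_of_lt (by simpa using hx))
      simp [w, this]) hw
  -- For `z` near `c`, `n i z` is the point whose midpoint with its image is `z`, and `v i z` is its
  -- displacement.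
  let v : ι → E → E := fun i z => u i (n i z) - n i z
  have hv : ∀ z ∈ ball c R, CkConv k l v (fun _ => 0) z := fun z hz =>
    (hdiff (id z) hz).comp (hn z)
  let β : ι → E → E →L[ℝ] ℝ := fun i z => J (v i z)
  have hβ : ∀ z ∈ ball c R, CkConv k l β (fun _ => 0) z := fun z hz =>
    ((hv z hz).clm (J : E →L[ℝ] E →L[ℝ] ℝ)).congr (Eventually.of_forall fun _ => rfl)
      (Eventually.of_forall fun y => by simp)
  have hsub4 : closedBall c (R / 4) ⊆ ball c R := closedBall_subset_ball (by linarith)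
  have hnb : ∀ᶠ i in l, ∀ z ∈ closedBall c (R / 4), n i z ∈ ball c (R / 2) :=
    (isCompact_closedBall c (R / 4)).eventually_forall_of_prod_nhds
      (P := fun i z => n i z ∈ ball c (R / 2)) fun z hz =>
      (hn z).tendsto.eventually (isOpen_ball.mem_nhds
        (closedBall_subset_ball (by linarith : R / 4 < R / 2) hz))
  have hud : ∀ᶠ i in l, ∀ x ∈ closedBall c (R / 2), ContDiffAt ℝ k (u i) x :=
    CkConv.eventually_contDiffAt_of_isCompact (isCompact_closedBall _ _) fun x hx =>
      hu x (closedBall_subset_ball (by linarith) hx)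
  -- A point and its image are `z - v / 2` and `z + v / 2`. Comparing derivatives by the chain rule
  -- turns symplecticity of `u` into the hypothesis of `symm_of_cayley_symplectic`, so `β` is
  -- closed.
  have hclosed : ∀ᶠ i in l, ∀ z ∈ ball c (R / 4), DifferentiableAt ℝ (β i) z ∧
      ∀ a b, fderiv ℝ (β i) z a b = fderiv ℝ (β i) z b a := by
    filter_upwards [hni, hnb, hud, hs] with i h1 h2 h3 h4 z hz
    have hmid : ∀ y ∈ ball c (R / 4), n i y = y - (1 / 2 : ℝ) • v i y ∧
        u i (n i y) = y + (1 / 2 : ℝ) • v i y := fun y hy => by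
      have e1 := h1.2.2.1 y
      simp only at e1
      rw [hw1 i (n i y) (ball_subset_closedBall (h2 y (ball_subset_closedBall hy)))] at e1
      have e2 : n i y = y - (1 / 2 : ℝ) • v i y := eq_sub_of_add_eq e1
      refine ⟨e2, ?_⟩
      have e3 : u i (n i y) = n i y + v i y := by simp [v]
      rw [e3]
      nth_rewrite 1 [e2]
      module
    have hnz := h2 z (ball_subset_closedBall hz)
    have hdn : DifferentiableAt ℝ (n i) z := h1.2.2.2.differentiable hk0 z
    have hdu : DifferentiableAt ℝ (u i) (n i z) :=
      (h3 _ (ball_subset_closedBall hnz)).differentiableAt hk0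
    have hdv : DifferentiableAt ℝ (v i) z := (hdu.comp z hdn).sub hdn
    have hβd : HasFDerivAt (β i) ((J : E →L[ℝ] E →L[ℝ] ℝ).comp (fderiv ℝ (v i) z)) z :=
      (J : E →L[ℝ] E →L[ℝ] ℝ).hasFDerivAt.comp z hdv.hasFDerivAt
    refine ⟨hβd.differentiableAt, fun a b => ?_⟩
    rw [hβd.fderiv]
    have hnhds : ball c (R / 4) ∈ 𝓝 z := isOpen_ball.mem_nhds hz
    have d1 : HasFDerivAt (n i) (ContinuousLinearMap.id ℝ E - (1 / 2 : ℝ) • fderiv ℝ (v i) z) z :=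
      ((hasFDerivAt_id z).sub (hdv.hasFDerivAt.const_smul (1 / 2 : ℝ))).congr_of_eventuallyEq
        (by filter_upwards [hnhds] with y hy using (hmid y hy).1)
    have d2 : HasFDerivAt (u i ∘ n i)
        (ContinuousLinearMap.id ℝ E + (1 / 2 : ℝ) • fderiv ℝ (v i) z) z :=
      ((hasFDerivAt_id z).add (hdv.hasFDerivAt.const_smul (1 / 2 : ℝ))).congr_of_eventuallyEq
        (by filter_upwards [hnhds] with y hy using (hmid y hy).2)
    have d3 := (hdu.hasFDerivAt.comp z d1).unique d2
    have h5 := h4 (n i z) (ball_subset_ball (by linarith) hnz)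
    refine symm_of_cayley_symplectic (J := (J : E →L[ℝ] E →L[ℝ] ℝ)) hJ (A := fderiv ℝ (v i) z) ?_
    have e1 : ∀ p, p + (1 / 2 : ℝ) • fderiv ℝ (v i) z p =
        fderiv ℝ (u i) (n i z) (p - (1 / 2 : ℝ) • fderiv ℝ (v i) z p) := fun p => by
      have := DFunLike.congr_fun d3 p
      simpa using this.symm
    rw [e1 a, e1 b]
    exact h5 _ _
  have hex : ∀ᶠ i in l, ∃ S : E → ℝ, S c = 0 ∧ ∀ z ∈ ball c (R / 4), HasFDerivAt S (β i z) z := by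
    filter_upwards [hclosed] with i hi
    obtain ⟨S, hS⟩ := (convex_ball c (R / 4)).exists_forall_hasFDerivAt_of_fderiv_symmetric
      isOpen_ball (fun z hz => (hi z hz).1.differentiableWithinAt) (fun z hz => (hi z hz).2)
    -- Fixing the constant of integration makes the primitives themselves, and not only their
    -- differentials, converge to zero.
    exact ⟨fun z => S z - S c, sub_self _, fun z hz => (hS z hz).sub_const _⟩
  obtain ⟨S, hS⟩ := skolem.1 hex
  refine ⟨S, fun z hz => ?_, ?_⟩
  · refine CkConv.of_hasFDerivAt (F' := β) (f' := fun _ => 0) ?_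
      (Eventually.of_forall fun y => hasFDerivAt_const _ _) ?_ (hβ z (hsub4 (ball_subset_closedBall hz)))
    · refine ((hS.prod_inl (𝓝 z)).and ((isOpen_ball.eventually_mem hz).prod_inr l)).mono fun p hp => hp.1.2 _ hp.2
    · rw [Metric.tendsto_nhds]
      intro ε hε
      have hb := CkConv.eventually_norm_lt_of_isCompact (isCompact_closedBall c (R / 4))
        (fun x hx => hβ x (hsub4 hx)) (ε := ε / R) (by positivity)
      refine (((hS.and hb).prod_inl (𝓝 z)).and ((isOpen_ball.eventually_mem hz).prod_inr l)).mono fun p hp => ?_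
      obtain ⟨⟨⟨hS0, hSd⟩, hβb⟩, hpz⟩ := hp
      have := (convex_ball c (R / 4)).norm_image_sub_le_of_norm_hasFDerivWithin_le
        (fun x hx => (hSd x hx).hasFDerivWithinAt)
        (fun x hx => (hβb x (ball_subset_closedBall hx)).le) (mem_ball_self (by linarith)) hpz
      rw [hS0, sub_zero] at this
      rw [dist_zero_right]
      refine this.trans_lt ?_
      have h6 : ‖p.2 - c‖ < R := by rw [← dist_eq_norm]; exact (mem_ball.1 hpz).trans (by linarith)
      calc ε / R * ‖p.2 - c‖ < ε / R * R := by gcongr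
        _ = ε := by field_simp
  -- A displacement below `R / 16` moves the midpoint by less than `R / 32`, and `R / 16 + R / 32 <
  -- R / 8`.
  · have hwb := CkConv.eventually_norm_lt_of_isCompact (isCompact_closedBall c (R / 2))
      (fun x hx => hdiff x (closedBall_subset_ball (by linarith) hx)) (ε := R / 16) (by positivity)
    filter_upwards [hS, hni, hwb] with i h1 h2 h3 x hx
    have hx2 : x ∈ closedBall c (R / 2) := ball_subset_closedBall (ball_subset_ball (by linarith) hx)
    have hz : x + (1 / 2 : ℝ) • (u i x - x) ∈ ball c (R / 8) := by
      rw [mem_ball, dist_eq_norm] at hx ⊢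
      calc ‖x + (1 / 2 : ℝ) • (u i x - x) - c‖ = ‖(x - c) + (1 / 2 : ℝ) • (u i x - x)‖ := by
            congr 1; module
        _ ≤ ‖x - c‖ + ‖(1 / 2 : ℝ) • (u i x - x)‖ := norm_add_le _ _
        _ = ‖x - c‖ + (1 / 2) * ‖u i x - x‖ := by rw [norm_smul]; norm_num
        _ < R / 8 := by linarith [h3 x hx2]
    refine ⟨hz, ?_⟩
    have hnz : n i (x + (1 / 2 : ℝ) • (u i x - x)) = x := by
      rw [← hw1 i x hx2]; exact h2.2.1 x
    have := h1.2 _ (ball_subset_ball (by linarith) hz)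
    simp only [β, v, hnz] at this
    exact this

end LocalExtension

/-! ### Global symplectic maps from cut-off generating functions. -/

section LocalExtension

variable {ι E : Type*} [NormedAddCommGroup E] [NormedSpace ℝ E] [FiniteDimensional ℝ E]
  {k : ℕ} {l : Filter ι}

/-- Generating functions converging to zero and supported in a fixed compact set define
global symplectic diffeomorphisms converging to the identity. -/
theorem exists_symplectic_of_generating_function (J : E ≃L[ℝ] (E →L[ℝ] ℝ))
    (hJ : ∀ a b, J a b = -J b a) (hk : 1 ≤ k) {T : ι → E → ℝ} {A : Set E} (hA : IsCompact A)
    (hT0 : ∀ i, ∀ x ∉ A, T i x = 0) (hT : ∀ x, CkConv (k + 1) l T (fun _ => 0) x) :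
    ∃ P Q : ι → E → E, (∀ x, CkConv k l P id x) ∧ (∀ ε > 0, ∀ᶠ i in l, ∀ z, ‖fderiv ℝ (T i) z‖ < ε) ∧
      ∀ᶠ i in l, Function.LeftInverse (Q i) (P i) ∧ Function.RightInverse (Q i) (P i) ∧
        ContDiff ℝ k (P i) ∧ ContDiff ℝ k (Q i) ∧
        (∀ x a b, J (fderiv ℝ (P i) x a) (fderiv ℝ (P i) x b) = J a b) ∧
        ∀ x, ∃ z, x = z - (1 / 2 : ℝ) • J.symm (fderiv ℝ (T i) z) ∧
          P i x = z + (1 / 2 : ℝ) • J.symm (fderiv ℝ (T i) z) ∧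
          ∀ y, x = y - (1 / 2 : ℝ) • J.symm (fderiv ℝ (T i) y) → z = y := by
  have hk0 : (k : ℕ∞ω) ≠ 0 := by simp; omega
  let Js : (E →L[ℝ] ℝ) →L[ℝ] E := (J.symm : (E →L[ℝ] ℝ) →L[ℝ] E)
  have hdT0 : ∀ i, ∀ x ∉ A, fderiv ℝ (T i) x = 0 := fun i x hx => by
    have : T i =ᶠ[𝓝 x] fun _ => 0 := by
      filter_upwards [hA.isClosed.isOpen_compl.mem_nhds hx] with y hy using hT0 i y hy
    rw [this.fderiv_eq]; simp
  have hdT : ∀ x, CkConv k l (fun i => fderiv ℝ (T i)) (fun _ => 0) x := fun x => by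
    have := (hT x).fderiv
    simpa using! this
  have hsmall : ∀ ε > 0, ∀ᶠ i in l, ∀ z, ‖fderiv ℝ (T i) z‖ < ε := fun ε hε => by
    filter_upwards [CkConv.eventually_norm_lt_of_isCompact hA (fun x _ => hdT x) hε] with i hi z
    by_cases hz : z ∈ A
    · exact hi z hz
    · rw [hdT0 i z hz]; simpa
  have hcv : ∀ (s : ℝ) x, CkConv k l (fun i z => (s • Js) (fderiv ℝ (T i) z)) (fun _ => 0) x :=
    fun s x => ((hdT x).clm (s • Js)).congr (Eventually.of_forall fun _ => rfl)
      (Eventually.of_forall fun y => by simp)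
  obtain ⟨na, hna, hnai⟩ := CkConv.exists_inverse_of_support hk hA
    (w := fun i z => ((-(1 / 2 : ℝ)) • Js) (fderiv ℝ (T i) z))
    (fun i x hx => by simp [hdT0 i x hx]) (hcv _)
  obtain ⟨nb, hnb, hnbi⟩ := CkConv.exists_inverse_of_support hk hA
    (w := fun i z => ((1 / 2 : ℝ) • Js) (fderiv ℝ (T i) z))
    (fun i x hx => by simp [hdT0 i x hx]) (hcv _)
  have hTd : ∀ᶠ i in l, ∀ x, ContDiffAt ℝ (k + 1 : ℕ) (T i) x := by
    filter_upwards [CkConv.eventually_contDiffAt_of_isCompact hA fun x _ => hT x] with i hi x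
    by_cases hx : x ∈ A
    · exact hi x hx
    · refine contDiffAt_const (c := (0 : ℝ)) |>.congr_of_eventuallyEq ?_
      filter_upwards [hA.isClosed.isOpen_compl.mem_nhds hx] with y hy using hT0 i y hy
  -- `a i z` and `b i z` are the point and the image having midpoint `z`, so the map sought is `b i
  -- ∘ (a i)⁻¹`.
  let a : ι → E → E := fun i z => z + ((-(1 / 2 : ℝ)) • Js) (fderiv ℝ (T i) z)
  let b : ι → E → E := fun i z => z + ((1 / 2 : ℝ) • Js) (fderiv ℝ (T i) z)
  have hb : ∀ x, CkConv k l b id x := fun x =>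
    ((CkConv.const (f := fun x : E => x) contDiffAt_id).add (hcv (1 / 2) x)).congr
      (Eventually.of_forall fun _ => rfl) (Eventually.of_forall fun y => by simp)
  refine ⟨fun i => b i ∘ na i, fun i => a i ∘ nb i, fun x => (hb (id x)).comp (hna x), hsmall, ?_⟩
  filter_upwards [hnai, hnbi, hTd] with i h1 h2 h3
  have ea : ∀ z, a i z = z - (1 / 2 : ℝ) • J.symm (fderiv ℝ (T i) z) := fun z => by
    simp only [a, Js, neg_smul, smul_apply, ContinuousLinearEquiv.coe_coe]
    module
  have eb : ∀ z, b i z = z + (1 / 2 : ℝ) • J.symm (fderiv ℝ (T i) z) := fun z => rfl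
  have la : Function.LeftInverse (na i) (a i) := h1.2.1
  have ra : Function.RightInverse (na i) (a i) := h1.2.2.1
  have lb : Function.LeftInverse (nb i) (b i) := h2.2.1
  have rb : Function.RightInverse (nb i) (b i) := h2.2.2.1
  have cb : ContDiff ℝ k (b i) := contDiff_id.add h2.1
  have ca : ContDiff ℝ k (a i) := contDiff_id.add h1.1
  refine ⟨fun x => ?_, fun x => ?_, cb.comp h1.2.2.2, ca.comp h2.2.2.2, fun x p q => ?_, fun x => ?_⟩
  · simp only [Function.comp]; rw [lb, ra]
  · simp only [Function.comp]; rw [la, rb]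
  · set z := na i x with hz
    -- The derivative of `P i` is the Cayley transform of `B = J⁻¹ D²T`. Equality of mixed second
    -- derivatives, available since `k + 1 ≥ 2`, makes `B` infinitesimally symplectic.
    have hsymm : IsSymmSndFDerivAt ℝ (T i) z := (h3 z).isSymmSndFDerivAt (by
      simp only [minSmoothness_of_isRCLikeNormedField]
      exact_mod_cast (by omega : 2 ≤ k + 1))
    have hdd : DifferentiableAt ℝ (fderiv ℝ (T i)) z :=
      ((h3 z).fderiv_right (m := k) (by simp)).differentiableAt hk0
    let B : E →L[ℝ] E := Js.comp (fderiv ℝ (fderiv ℝ (T i)) z)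
    have hB : ∀ p q, J (B p) q = J (B q) p := fun p q => by
      simp only [B, Js, ContinuousLinearMap.comp_apply, ContinuousLinearEquiv.coe_coe,
        ContinuousLinearEquiv.apply_symm_apply]
      exact hsymm p q
    have db : HasFDerivAt (b i) (ContinuousLinearMap.id ℝ E + ((1 / 2 : ℝ) • Js).comp
        (fderiv ℝ (fderiv ℝ (T i)) z)) z :=
      (hasFDerivAt_id z).add (((1 / 2 : ℝ) • Js).hasFDerivAt.comp z hdd.hasFDerivAt)
    have da : HasFDerivAt (a i) (ContinuousLinearMap.id ℝ E + ((-(1 / 2 : ℝ)) • Js).comp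
        (fderiv ℝ (fderiv ℝ (T i)) z)) z :=
      (hasFDerivAt_id z).add (((-(1 / 2 : ℝ)) • Js).hasFDerivAt.comp z hdd.hasFDerivAt)
    have dn : HasFDerivAt (na i) (fderiv ℝ (na i) x) x :=
      (h1.2.2.2.differentiable hk0 x).hasFDerivAt
    have e1 : ∀ p, p = fderiv ℝ (na i) x p - (1 / 2 : ℝ) • B (fderiv ℝ (na i) x p) := fun p => by
      have e2 : HasFDerivAt (a i ∘ na i) (ContinuousLinearMap.id ℝ E) x := by
        rw [ra.comp_eq_id]; exact hasFDerivAt_id x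
      have := DFunLike.congr_fun ((da.comp x dn).unique e2) p
      simp at this
      nth_rewrite 1 [← this]
      simp only [B, ContinuousLinearMap.comp_apply]
      module
    have e3 : ∀ p, fderiv ℝ (b i ∘ na i) x p =
        fderiv ℝ (na i) x p + (1 / 2 : ℝ) • B (fderiv ℝ (na i) x p) := fun p => by
      rw [(db.comp x dn).fderiv]; simp [B]
    rw [e3, e3]
    have := cayley_symplectic (J := (J : E →L[ℝ] E →L[ℝ] ℝ)) hJ hB (fderiv ℝ (na i) x p)
      (fderiv ℝ (na i) x q)
    rw [← e1 p, ← e1 q] at this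
    exact this
  · refine ⟨na i x, ?_, rfl, fun y hy => ?_⟩
    · rw [← ea]; exact (ra x).symm
    · rw [← ea] at hy; rw [hy]; exact la y

/-- **Local extension of symplectic maps.** Symplectic maps of a ball which converge to the
identity agree on a smaller ball with global symplectic diffeomorphisms which are the identity
off the ball, and which converge to the identity. -/
theorem exists_symplectic_extension (J : E ≃L[ℝ] (E →L[ℝ] ℝ)) (hJ : ∀ a b, J a b = -J b a)
    (hk : 1 ≤ k) {c : E} {R : ℝ} (hR : 0 < R) {u : ι → E → E}
    (hu : ∀ x ∈ ball c R, CkConv k l u id x)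
    (hs : ∀ᶠ i in l, ∀ x ∈ ball c R, ∀ a b,
      J (fderiv ℝ (u i) x a) (fderiv ℝ (u i) x b) = J a b) :
    ∃ P Q : ι → E → E, (∀ x, CkConv k l P id x) ∧ ∀ᶠ i in l,
      Function.LeftInverse (Q i) (P i) ∧ Function.RightInverse (Q i) (P i) ∧
      ContDiff ℝ k (P i) ∧ ContDiff ℝ k (Q i) ∧
      (∀ x a b, J (fderiv ℝ (P i) x a) (fderiv ℝ (P i) x b) = J a b) ∧
      (∀ x ∈ ball c (R / 16), P i x = u i x) ∧ ∀ x ∉ ball c (R / 2), P i x = x := by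
  obtain ⟨S, hS, hSu⟩ := exists_generating_function J hJ hk hR hu hs
  -- The bump is `1` on `ball c (R / 8)`, which contains the midpoints of points of `ball c (R /
  -- 16)`; its support lies in `ball c (R / 4)`, where `S` is controlled.
  let ρ : ContDiffBump c := ⟨R / 8, 3 * R / 16, by linarith, by linarith⟩
  let T : ι → E → ℝ := fun i x => ρ x • S i x
  have hT0 : ∀ i, ∀ x ∉ closedBall c (3 * R / 16), T i x = 0 := fun i x hx => by
    have : ρ x = 0 := ρ.zero_of_le_dist (le_of_lt (by simpa using hx))
    simp [T, this]
  have hT : ∀ x, CkConv (k + 1) l T (fun _ => 0) x :=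
    CkConv.zero_of_support isClosed_closedBall hT0 fun x hx =>
      ((CkConv.const ρ.contDiffAt).smul (hS x (closedBall_subset_ball (by linarith) hx))).congr
        (Eventually.of_forall fun _ => rfl) (Eventually.of_forall fun y => by simp)
  obtain ⟨P, Q, hP, hsmall, hPQ⟩ := exists_symplectic_of_generating_function J hJ hk
    (isCompact_closedBall c (3 * R / 16)) hT0 hT
  refine ⟨P, Q, hP, ?_⟩
  obtain ⟨C, hC0, hC⟩ := (J.symm : (E →L[ℝ] ℝ) →L[ℝ] E).bound
  filter_upwards [hPQ, hSu, hsmall (R / (16 * C)) (by positivity)] with i h1 h2 h3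
  refine ⟨h1.1, h1.2.1, h1.2.2.1, h1.2.2.2.1, h1.2.2.2.2.1, fun x hx => ?_, fun x hx => ?_⟩
  · obtain ⟨z, hz1, hz2, hz3⟩ := h1.2.2.2.2.2 x
    obtain ⟨hm, hd⟩ := h2 x hx
    have hTd : fderiv ℝ (T i) (x + (1 / 2 : ℝ) • (u i x - x)) = J (u i x - x) := by
      have : T i =ᶠ[𝓝 (x + (1 / 2 : ℝ) • (u i x - x))] S i := by
        filter_upwards [ρ.eventuallyEq_one_of_mem_ball hm] with y hy
        simp [T, hy]
      rw [this.fderiv_eq, hd.fderiv]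
    -- Uniqueness identifies `z` with the midpoint of `x` and `u i x`.
    have hz := hz3 (x + (1 / 2 : ℝ) • (u i x - x)) (by
      rw [hTd, J.symm_apply_apply]; module)
    rw [hz2, hz, hTd, J.symm_apply_apply]
    module
  · obtain ⟨z, hz1, hz2, -⟩ := h1.2.2.2.2.2 x
    by_cases hz : z ∈ closedBall c (3 * R / 16)
    -- If `z` lay in the support, `x` would be within `3 * R / 16 + R / 32 < R / 2` of `c`.
    · exfalso
      apply hx
      have h4 : ‖J.symm (fderiv ℝ (T i) z)‖ < R / 16 := by
        calc _ ≤ C * ‖fderiv ℝ (T i) z‖ := hC _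
          _ < C * (R / (16 * C)) := by gcongr; exact h3 z
          _ = R / 16 := by field_simp
      rw [mem_closedBall, dist_eq_norm] at hz
      rw [mem_ball, dist_eq_norm, hz1]
      calc ‖z - (1 / 2 : ℝ) • J.symm (fderiv ℝ (T i) z) - c‖
          = ‖(z - c) - (1 / 2 : ℝ) • J.symm (fderiv ℝ (T i) z)‖ := by congr 1; module
        _ ≤ ‖z - c‖ + ‖(1 / 2 : ℝ) • J.symm (fderiv ℝ (T i) z)‖ := norm_sub_le _ _
        _ = ‖z - c‖ + (1 / 2) * ‖J.symm (fderiv ℝ (T i) z)‖ := by rw [norm_smul]; norm_num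
        _ < R / 2 := by linarith
    · have : fderiv ℝ (T i) z = 0 := by
        have : T i =ᶠ[𝓝 z] fun _ => 0 := by
          filter_upwards [isClosed_closedBall.isOpen_compl.mem_nhds hz] with y hy using hT0 i y hy
        rw [this.fderiv_eq]; simp
      rw [hz2, hz1, this]; simp

end LocalExtension

/-! ### Superposition operators on spaces of continuous functions. -/

section Superposition

universe u

variable {K : Type*} [TopologicalSpace K] [CompactSpace K]
  {X Y : Type u} [NormedAddCommGroup X] [NormedSpace ℝ X] [NormedAddCommGroup Y] [NormedSpace ℝ Y]

/-- Pointwise application of a continuous family of linear maps to a continuous function. -/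
noncomputable def ContinuousMap.applyCLM (K X Y : Type*) [TopologicalSpace K] [CompactSpace K]
    [NormedAddCommGroup X] [NormedSpace ℝ X] [NormedAddCommGroup Y] [NormedSpace ℝ Y] :
    C(K, X →L[ℝ] Y) →L[ℝ] C(K, X) →L[ℝ] C(K, Y) :=
  LinearMap.mkContinuous₂
    (LinearMap.mk₂ ℝ (fun (A : C(K, X →L[ℝ] Y)) (γ : C(K, X)) =>
        (⟨fun t => A t (γ t), by fun_prop⟩ : C(K, Y)))
      (fun A B γ => by ext; simp) (fun c A γ => by ext; simp)
      (fun A γ δ => by ext; simp) (fun c A γ => by ext; simp)) 1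
    (fun A γ => by
      rw [one_mul]
      refine (ContinuousMap.norm_le _ (by positivity)).2 fun t => ?_
      exact (A t).le_opNorm_of_le (γ.norm_coe_le_norm t) |>.trans
        (by gcongr; exact A.norm_coe_le_norm t))

@[simp] theorem ContinuousMap.applyCLM_apply (A : C(K, X →L[ℝ] Y)) (γ : C(K, X)) (t : K) :
    ContinuousMap.applyCLM K X Y A γ t = A t (γ t) := rfl

/-- The superposition operator `γ ↦ g ∘ γ` is differentiable if `g` is of class `C^1`. -/
theorem ContinuousMap.hasFDerivAt_comp {g : X → Y} {g' : C(X, X →L[ℝ] Y)} (hc : Continuous g)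
    (hg : ∀ x, HasFDerivAt g (g' x) x) (γ : C(K, X)) :
    HasFDerivAt (fun γ : C(K, X) => (⟨g, hc⟩ : C(X, Y)).comp γ)
      (ContinuousMap.applyCLM K X Y (g'.comp γ)) γ := by
  rw [hasFDerivAt_iff_isLittleO_nhds_zero, Asymptotics.isLittleO_iff]
  intro ε hε
  -- Continuity of postcomposition plays the role of uniform continuity of `g'` near the compact
  -- image of `γ`.
  have h1 : ContinuousAt (fun h : C(K, X) => g'.comp (γ + h)) 0 :=
    ((ContinuousMap.continuous_postcomp g').comp (continuous_const.add continuous_id)).continuousAt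
  obtain ⟨δ, hδ, h2⟩ := (Metric.continuousAt_iff (α := C(K, X)) (β := C(K, X →L[ℝ] Y))).1 h1 ε hε
  filter_upwards [ball_mem_nhds (0 : C(K, X)) hδ] with h hh
  rw [mem_ball, dist_zero_right] at hh
  refine (ContinuousMap.norm_le _ (by positivity)).2 fun t => ?_
  have h3 : ∀ y ∈ segment ℝ (γ t) (γ t + h t), ‖g' y - g' (γ t)‖ ≤ ε := by
    rintro y hy
    rw [segment_eq_image'] at hy
    obtain ⟨s, hs, rfl⟩ := hy
    have h4 : ‖s • h‖ < δ := by
      rw [norm_smul, Real.norm_of_nonneg hs.1]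
      exact (mul_le_of_le_one_left (norm_nonneg _) hs.2).trans_lt hh
    have h5 := h2 (x := s • h) (by rwa [dist_zero_right])
    have h6 := (ContinuousMap.dist_apply_le_dist (f := g'.comp (γ + s • h)) (g := g'.comp (γ + 0))
      t).trans h5.le
    simpa [dist_eq_norm] using h6
  have h7 := (convex_segment (γ t) (γ t + h t)).norm_image_sub_le_of_norm_hasFDerivWithin_le'
    (fun y _ => (hg y).hasFDerivWithinAt) h3 (left_mem_segment ℝ _ _) (right_mem_segment ℝ _ _)
  rw [add_sub_cancel_left] at h7
  exact h7.trans (by gcongr; exact h.norm_coe_le_norm t)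

/-- Induction on `n`: the derivative is `applyCLM` after the superposition operator of `fderiv ℝ g`.
The target changes from `Y` to `X →L[ℝ] Y`, which is why `X` and `Y` share a universe. -/
theorem ContinuousMap.contDiff_comp {n : ℕ} {g : X → Y} (hc : Continuous g)
    (hg : ContDiff ℝ n g) : ContDiff ℝ n (fun γ : C(K, X) => (⟨g, hc⟩ : C(X, Y)).comp γ) := by
  induction n generalizing Y with
  | zero =>
    rw [Nat.cast_zero, contDiff_zero]
    exact ContinuousMap.continuous_postcomp _
  | succ n ih =>
    have hg1 : ContDiff ℝ n (fderiv ℝ g) := hg.fderiv_right (by simp)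
    have hd : ∀ γ : C(K, X), HasFDerivAt (fun γ : C(K, X) => (⟨g, hc⟩ : C(X, Y)).comp γ)
        (ContinuousMap.applyCLM K X Y ((⟨fderiv ℝ g, hg1.continuous⟩ : C(X, X →L[ℝ] Y)).comp γ)) γ :=
      fun γ => ContinuousMap.hasFDerivAt_comp (g' := ⟨fderiv ℝ g, hg1.continuous⟩) hc
        (fun x => (hg.differentiable (by simp) x).hasFDerivAt) γ
    rw [Nat.cast_succ]
    refine (contDiff_succ_iff_hasFDerivAt).2 ⟨_, ?_, hd⟩
    exact (ContinuousMap.applyCLM K X Y).contDiff.comp (ih hg1.continuous hg1)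

end Superposition

/-! ### Primitives of curves and differentiation under the integral sign. -/

section Integration

open unitInterval MeasureTheory

universe u

variable {X Y : Type u} [NormedAddCommGroup X] [NormedSpace ℝ X] [NormedAddCommGroup Y]
  [NormedSpace ℝ Y]

/-- Primitive vanishing at zero, as an operator on continuous functions. -/
noncomputable def volterra (X : Type*) [NormedAddCommGroup X] [NormedSpace ℝ X] :
    C(I, X) →L[ℝ] C(I, X) :=
  LinearMap.mkContinuous
    { toFun := fun γ => ⟨fun t => ∫ s in (0 : ℝ)..t, γ (Set.projIcc 0 1 zero_le_one s), by
        have : Continuous fun t : ℝ => ∫ s in (0 : ℝ)..t, γ (Set.projIcc 0 1 zero_le_one s) :=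
          intervalIntegral.continuous_primitive
            (fun a b => (γ.continuous.comp continuous_projIcc).intervalIntegrable a b) 0
        exact this.comp continuous_subtype_val⟩
      map_add' := fun γ δ => by
        ext t
        exact intervalIntegral.integral_add
          ((γ.continuous.comp continuous_projIcc).intervalIntegrable _ _)
          ((δ.continuous.comp continuous_projIcc).intervalIntegrable _ _)
      map_smul' := fun c γ => by
        ext t
        exact intervalIntegral.integral_smul c _ } 1
    (fun γ => by
      rw [one_mul]
      refine (ContinuousMap.norm_le _ (norm_nonneg _)).2 fun t => ?_
      refine (intervalIntegral.norm_integral_le_of_norm_le_const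
        (C := ‖γ‖) fun s _ => γ.norm_coe_le_norm _).trans ?_
      rw [sub_zero, abs_of_nonneg t.2.1]
      exact mul_le_of_le_one_right (norm_nonneg _) t.2.2)

theorem volterra_apply (γ : C(I, X)) (t : I) :
    volterra X γ t = ∫ s in (0 : ℝ)..t, γ (Set.projIcc 0 1 zero_le_one s) := rfl

theorem volterra_zero (γ : C(I, X)) : volterra X γ 0 = 0 := by
  simp [volterra_apply]

/-- Interior times only: `Set.projIcc` freezes the parameter outside the interval, so a two-sided
derivative need not exist at the endpoints. -/
theorem hasDerivAt_volterra [CompleteSpace X] (γ : C(I, X)) {t : ℝ} (ht : t ∈ Set.Ioo (0 : ℝ) 1) :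
    HasDerivAt (fun s => volterra X γ (Set.projIcc 0 1 zero_le_one s))
      (γ (Set.projIcc 0 1 zero_le_one t)) t := by
  have hc : Continuous fun s : ℝ => γ (Set.projIcc 0 1 zero_le_one s) :=
    γ.continuous.comp continuous_projIcc
  refine (hc.integral_hasStrictDerivAt 0 t).hasDerivAt.congr_of_eventuallyEq ?_
  filter_upwards [Ioo_mem_nhds ht.1 ht.2] with s hs
  rw [volterra_apply, Set.projIcc_of_mem zero_le_one ⟨hs.1.le, hs.2.le⟩]

/-- The graph of a curve. -/
theorem contDiff_graph {n : ℕ∞ω} :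
    ContDiff ℝ n (fun γ : C(I, X) => (⟨fun t : I => ((t : ℝ), γ t), by fun_prop⟩ : C(I, ℝ × X))) ∧
    ∀ γ : C(I, X), HasFDerivAt
      (fun γ : C(I, X) => (⟨fun t : I => ((t : ℝ), γ t), by fun_prop⟩ : C(I, ℝ × X)))
      ((ContinuousLinearMap.inr ℝ ℝ X).compLeftContinuous ℝ I) γ := by
  have h : (fun γ : C(I, X) => (⟨fun t : I => ((t : ℝ), γ t), by fun_prop⟩ : C(I, ℝ × X))) =
      fun γ => (⟨fun t : I => ((t : ℝ), (0 : X)), by fun_prop⟩ : C(I, ℝ × X)) +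
        (ContinuousLinearMap.inr ℝ ℝ X).compLeftContinuous ℝ I γ := by
    ext γ t <;> simp
  rw [h]
  exact ⟨contDiff_const.add (ContinuousLinearMap.contDiff _), fun γ =>
    (ContinuousLinearMap.hasFDerivAt _).const_add _⟩

/-- Time-dependent superposition operators are smooth. -/
theorem contDiff_superposition {n : ℕ} (hn : 1 ≤ n) {g : ℝ × X → Y} (hg : ContDiff ℝ n g) :
    ContDiff ℝ n (fun γ : C(I, X) => (⟨fun t : I => g ((t : ℝ), γ t), by
      have := hg.continuous; fun_prop⟩ : C(I, Y))) ∧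
    ∀ γ : C(I, X), ∃ D : C(I, X) →L[ℝ] C(I, Y), HasFDerivAt
      (fun γ : C(I, X) => (⟨fun t : I => g ((t : ℝ), γ t), by
        have := hg.continuous; fun_prop⟩ : C(I, Y))) D γ ∧
      ∀ δ (t : I), D δ t = fderiv ℝ g ((t : ℝ), γ t) (0, δ t) := by
  have hg1 : Continuous (fderiv ℝ g) := hg.continuous_fderiv (by simp; omega)
  have hgc := hg.continuous
  constructor
  · exact (ContinuousMap.contDiff_comp hgc hg).comp contDiff_graph.1
  · intro γ
    refine ⟨_, (ContinuousMap.hasFDerivAt_comp (g' := ⟨fderiv ℝ g, hg1⟩) hg.continuous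
        (fun x => (hg.differentiable (by simp; omega) x).hasFDerivAt) _).comp γ
        ((contDiff_graph (n := 0)).2 γ), fun δ t => ?_⟩
    simp

/-- Differentiation under the integral sign. -/
theorem contDiff_integral_unitInterval [CompleteSpace Y] {n : ℕ} (hn : 1 ≤ n) {g : ℝ × X → Y}
    (hg : ContDiff ℝ n g) :
    ContDiff ℝ n (fun x => ∫ t in (0 : ℝ)..1, g (t, x)) ∧
    ∀ x a, fderiv ℝ (fun x => ∫ t in (0 : ℝ)..1, g (t, x)) x a =
      ∫ t in (0 : ℝ)..1, fderiv ℝ g (t, x) (0, a) := by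
  have hgc := hg.continuous
  let cst : X →L[ℝ] C(I, X) := ContinuousLinearMap.const ℝ I
  let ev : C(I, Y) →L[ℝ] Y := (ContinuousMap.evalCLM ℝ (1 : I)).comp (volterra Y)
  have hev : ∀ (f : ℝ → Y) (hf : Continuous f),
      ev ⟨fun t : I => f t, by fun_prop⟩ = ∫ t in (0 : ℝ)..1, f t := fun f hf => by
    change volterra Y _ 1 = _
    rw [volterra_apply]
    refine intervalIntegral.integral_congr fun s hs => ?_
    rw [Set.Icc.coe_one, Set.uIcc_of_le zero_le_one] at hs
    simp [Set.projIcc_of_mem zero_le_one hs]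
  -- The integral is a fixed linear functional applied to the superposition operator at a constant
  -- curve, whose differentiability it inherits.
  have heq : (fun x => ∫ t in (0 : ℝ)..1, g (t, x)) = fun x => ev ((fun γ : C(I, X) =>
      (⟨fun t : I => g ((t : ℝ), γ t), by fun_prop⟩ : C(I, Y))) (cst x)) := by
    ext x
    exact (hev (fun t => g (t, x)) (by fun_prop)).symm
  obtain ⟨h1, h2⟩ := contDiff_superposition hn hg
  rw [heq]
  refine ⟨ev.contDiff.comp (h1.comp cst.contDiff), fun x a => ?_⟩
  obtain ⟨D, hD, hDa⟩ := h2 (cst x)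
  have hd := ev.hasFDerivAt.comp x (hD.comp x cst.hasFDerivAt)
  simp only [Function.comp_def] at hd
  rw [hd.fderiv]
  have hg1 : Continuous (fderiv ℝ g) := hg.continuous_fderiv (by simp; omega)
  rw [← hev (fun t => fderiv ℝ g (t, x) (0, a)) (by fun_prop)]
  simp only [ContinuousLinearMap.comp_apply]
  congr 1
  ext t
  rw [hDa]; rfl

end Integration

/-! ### The flow of a vector field near a second-order zero. -/

section Flow

open unitInterval MeasureTheory

variable {E : Type*} [NormedAddCommGroup E] [NormedSpace ℝ E] [CompleteSpace E]

/-- Smooth dependence on initial conditions of the flow of a time-dependent vector field which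
vanishes to second order at the origin, together with the linearized equation. -/
theorem exists_flow_of_vanishing {n : ℕ} (hn : 1 ≤ n) {X : ℝ × E → E} (hX : ContDiff ℝ n X)
    (h0 : ∀ t, X (t, 0) = 0) (hd : ∀ t a, fderiv ℝ X (t, 0) (0, a) = 0) :
    ∃ Φ : E → C(I, E), ContDiffAt ℝ n Φ 0 ∧ Φ 0 = 0 ∧ (∀ a t, fderiv ℝ Φ 0 a t = a) ∧
      ∀ᶠ x in 𝓝 (0 : E), Φ x 0 = x ∧
        (∀ t ∈ Set.Ioo (0 : ℝ) 1, HasDerivAt (fun s => Φ x (Set.projIcc 0 1 zero_le_one s))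
          (X (t, Φ x (Set.projIcc 0 1 zero_le_one t))) t) ∧
        ∀ a, fderiv ℝ Φ x a 0 = a ∧ ∀ t ∈ Set.Ioo (0 : ℝ) 1,
          HasDerivAt (fun s => fderiv ℝ Φ x a (Set.projIcc 0 1 zero_le_one s))
            (fderiv ℝ X (t, Φ x (Set.projIcc 0 1 zero_le_one t))
              (0, fderiv ℝ Φ x a (Set.projIcc 0 1 zero_le_one t))) t := by
  have hn0 : (n : ℕ∞ω) ≠ 0 := by simp; omega
  have hXc := hX.continuous
  let cst : E →L[ℝ] C(I, E) := ContinuousLinearMap.const ℝ I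
  let N : C(I, E) → C(I, E) := fun γ => ⟨fun t : I => X ((t : ℝ), γ t), by fun_prop⟩
  obtain ⟨hN, hND⟩ := contDiff_superposition hn hX
  change ContDiff ℝ n N at hN
  change ∀ γ, ∃ D, HasFDerivAt N D γ ∧ _ at hND
  -- The integral equation of the flow is `Ψ γ = cst x`. Since `X` and its spatial derivative vanish
  -- at the origin, `Ψ` has derivative the identity at the zero curve, and the inverse function
  -- theorem gives existence up to time one together with `C^n` dependence on `x`.
  let Ψ : C(I, E) → C(I, E) := fun γ => γ - volterra E (N γ)
  have hΨ : ContDiff ℝ n Ψ := contDiff_id.sub ((volterra E).contDiff.comp hN)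
  have hΨ0 : Ψ 0 = 0 := by
    have : N 0 = 0 := by ext t; exact h0 t
    simp [Ψ, this]
  have hΨd : HasFDerivAt Ψ ((ContinuousLinearEquiv.refl ℝ C(I, E) : C(I, E) ≃L[ℝ] C(I, E)) :
      C(I, E) →L[ℝ] C(I, E)) 0 := by
    obtain ⟨D, hD, hDa⟩ := hND 0
    have hD0 : D = 0 := by
      ext γ t; rw [hDa]; exact hd _ _
    have := (hasFDerivAt_id (𝕜 := ℝ) (0 : C(I, E))).sub ((volterra E).hasFDerivAt.comp 0 hD)
    refine this.congr_fderiv ?_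
    ext γ t
    simp [hD0]
  have hst := hΨ.contDiffAt.hasStrictFDerivAt' hΨd hn0
  let inv : C(I, E) → C(I, E) := hst.localInverse Ψ _ 0
  have hinv0 : inv 0 = 0 := by
    have := hst.localInverse_apply_image
    rwa [hΨ0] at this
  have hinvC : ContDiffAt ℝ n inv 0 := by
    have := (hΨ.contDiffAt (x := 0)).to_localInverse hΨd hn0
    rwa [hΨ0] at this
  have hinvD : HasFDerivAt inv ((ContinuousLinearEquiv.refl ℝ C(I, E) : C(I, E) ≃L[ℝ] C(I, E)) :
      C(I, E) →L[ℝ] C(I, E)) 0 := by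
    have := hst.to_localInverse.hasFDerivAt
    rw [hΨ0] at this
    exact this
  have hright : ∀ᶠ γ in 𝓝 (0 : C(I, E)), Ψ (inv γ) = γ := by
    have := hst.eventually_right_inverse
    rwa [hΨ0] at this
  have hcst0 : cst 0 = 0 := map_zero cst
  let Φ : E → C(I, E) := fun x => inv (cst x)
  have hΦC : ContDiffAt ℝ n Φ 0 := by
    refine ContDiffAt.comp 0 ?_ cst.contDiff.contDiffAt
    rwa [hcst0]
  have hΦD : HasFDerivAt Φ cst 0 := by
    have h1 : HasFDerivAt inv ((ContinuousLinearEquiv.refl ℝ C(I, E) : C(I, E) ≃L[ℝ] C(I, E)) :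
      C(I, E) →L[ℝ] C(I, E)) (cst 0) := by rwa [hcst0]
    exact (h1.comp (0 : E) cst.hasFDerivAt).congr_fderiv (by ext; rfl)
  have hΦeq : ∀ᶠ x in 𝓝 (0 : E), Φ x = cst x + volterra E (N (Φ x)) := by
    have h1 : Tendsto cst (𝓝 0) (𝓝 0) := by
      have := cst.continuous.tendsto 0
      rwa [hcst0] at this
    filter_upwards [h1.eventually hright] with x hx
    exact (sub_eq_iff_eq_add.1 hx)
  refine ⟨Φ, hΦC, by simp [Φ, hcst0, hinv0], fun a t => by rw [hΦD.fderiv]; rfl, ?_⟩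
  filter_upwards [hΦeq.eventually_nhds, hΦC.eventually (by simp)] with x hx hxC
  have hderiv : ∀ (γ δ : C(I, E)) (y : E), γ = cst y + volterra E δ → γ 0 = y ∧
      ∀ t ∈ Set.Ioo (0 : ℝ) 1, HasDerivAt (fun s => γ (Set.projIcc 0 1 zero_le_one s))
        (δ (Set.projIcc 0 1 zero_le_one t)) t := by
    rintro γ δ y rfl
    refine ⟨?_, fun t ht => ?_⟩
    · rw [ContinuousMap.add_apply, volterra_zero, add_zero]; rfl
    · exact (hasDerivAt_volterra δ ht).const_add y
  obtain ⟨h1, h2⟩ := hderiv _ _ _ hx.self_of_nhds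
  have hproj : ∀ t ∈ Set.Ioo (0 : ℝ) 1, ((Set.projIcc 0 1 zero_le_one t : I) : ℝ) = t :=
    fun t ht => by rw [Set.projIcc_of_mem zero_le_one ⟨ht.1.le, ht.2.le⟩]
  refine ⟨h1, fun t ht => ?_, fun a => ?_⟩
  · have := h2 t ht
    simp only [N, ContinuousMap.coe_mk, hproj t ht] at this
    exact this
  · have hxd : HasFDerivAt Φ (fderiv ℝ Φ x) x := (hxC.differentiableAt hn0).hasFDerivAt
    obtain ⟨D, hD, hDa⟩ := hND (Φ x)
    -- Differentiating the integral equation in `x` gives the linearized equation in integral form.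
    have h3 : HasFDerivAt Φ (cst + (volterra E).comp (D.comp (fderiv ℝ Φ x))) x :=
      (cst.hasFDerivAt.add ((volterra E).hasFDerivAt.comp x (hD.comp x hxd))).congr_of_eventuallyEq hx
    have h4 : fderiv ℝ Φ x a = cst a + volterra E (D (fderiv ℝ Φ x a)) := by
      nth_rewrite 1 [h3.fderiv]; rfl
    obtain ⟨h5, h6⟩ := hderiv _ _ _ h4
    refine ⟨h5, fun t ht => ?_⟩
    have := h6 t ht
    simp only [hDa, hproj t ht] at this
    exact this

end Flow

/-! ### The Poincaré lemma for two-forms. -/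

section Poincare

set_option maxSynthPendingDepth 3

variable {E : Type*} [NormedAddCommGroup E] [NormedSpace ℝ E]

/-- Evaluation of bilinear forms at a pair of vectors. -/
noncomputable def evalBilin (p q : E) : (E →L[ℝ] E →L[ℝ] ℝ) →L[ℝ] ℝ :=
  (ContinuousLinearMap.apply ℝ ℝ q).comp (ContinuousLinearMap.apply ℝ (E →L[ℝ] ℝ) p)

/-- Poincaré lemma for two-forms on a ball. -/
theorem exists_primitive_twoForm {n : ℕ} (hn : 1 ≤ n) {η : E → E →L[ℝ] E →L[ℝ] ℝ}
    (hη : ContDiff ℝ n η) {r : ℝ} (hanti : ∀ x ∈ ball (0 : E) r, ∀ a b, η x a b = -η x b a)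
    (hclosed : ∀ x ∈ ball (0 : E) r, ∀ a b c,
      fderiv ℝ η x a b c - fderiv ℝ η x b a c + fderiv ℝ η x c a b = 0) :
    ∃ α : E → E →L[ℝ] ℝ, ContDiff ℝ n α ∧ α 0 = 0 ∧ (η 0 = 0 → fderiv ℝ α 0 = 0) ∧
      ∀ x ∈ ball (0 : E) r, ∀ a b, fderiv ℝ α x a b - fderiv ℝ α x b a = η x a b := by
  have hn0 : (n : ℕ∞ω) ≠ 0 := by simp; omega
  have hηc := hη.continuous
  have hηd : Continuous (fderiv ℝ η) := hη.continuous_fderiv hn0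
  -- Integrand of the radial homotopy formula `α x = ∫ t η(t x)(x, ·) dt`.
  let g : ℝ × E → E →L[ℝ] ℝ := fun p => p.1 • η (p.1 • p.2) p.2
  have hg : ContDiff ℝ n g := by
    have : ContDiff ℝ n fun p : ℝ × E => η (p.1 • p.2) := hη.comp (contDiff_fst.smul contDiff_snd)
    exact contDiff_fst.smul (this.clm_apply contDiff_snd)
  have hgc := hg.continuous
  have hgd : ∀ t x a, fderiv ℝ g (t, x) (0, a) =
      t • (t • fderiv ℝ η (t • x) a x + η (t • x) a) := by
    intro t x a
    have h1 : HasFDerivAt (fun y : E => t • η (t • y) y)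
        (t • ((η (t • x)).comp (ContinuousLinearMap.id ℝ E) +
          ((fderiv ℝ η (t • x)).comp (t • ContinuousLinearMap.id ℝ E)).flip x)) x := by
      have h2 : HasFDerivAt (fun y : E => η (t • y))
          ((fderiv ℝ η (t • x)).comp (t • ContinuousLinearMap.id ℝ E)) x :=
        ((hη.differentiable hn0 (t • x)).hasFDerivAt).comp x ((hasFDerivAt_id x).const_smul t)
      exact (h2.clm_apply (hasFDerivAt_id x)).const_smul t
    have h3 : HasFDerivAt (fun y : E => g (t, y))
        ((fderiv ℝ g (t, x)).comp (ContinuousLinearMap.inr ℝ ℝ E)) x :=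
      ((hg.differentiable hn0 (t, x)).hasFDerivAt).comp x (hasFDerivAt_prodMk_right t x)
    have h4 := DFunLike.congr_fun (h3.unique h1) a
    simp at h4
    rw [h4, add_comm]
    simp
  obtain ⟨hα, hαd⟩ := contDiff_integral_unitInterval hn hg
  refine ⟨_, hα, ?_, fun h0 => ?_, fun x hx a b => ?_⟩
  · simp [g]
  · ext a b
    rw [hαd]
    simp [hgd, h0]
  · have hcont : ∀ a : E, Continuous fun t : ℝ => fderiv ℝ g (t, x) (0, a) := fun a => by
      have : Continuous (fderiv ℝ g) := hg.continuous_fderiv hn0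
      fun_prop
    have heval : ∀ a b : E, fderiv ℝ (fun x => ∫ t in (0 : ℝ)..1, g (t, x)) x a b =
        ∫ t in (0 : ℝ)..1, fderiv ℝ g (t, x) (0, a) b := fun a b => by
      rw [hαd]
      exact ((ContinuousLinearMap.apply ℝ ℝ b).intervalIntegral_comp_comm
        ((hcont a).intervalIntegrable _ _)).symm
    rw [heval, heval, ← intervalIntegral.integral_sub
      (((hcont a).clm_apply continuous_const).intervalIntegrable _ _)
      (((hcont b).clm_apply continuous_const).intervalIntegrable _ _)]
    have hmem : ∀ t ∈ Set.Icc (0 : ℝ) 1, t • x ∈ ball (0 : E) r := fun t ht => by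
      rw [mem_ball_zero_iff] at hx ⊢
      rw [norm_smul, Real.norm_of_nonneg ht.1]
      exact (mul_le_of_le_one_left (norm_nonneg _) ht.2).trans_lt hx
    have hantiD : ∀ y ∈ ball (0 : E) r, ∀ c p q,
        fderiv ℝ η y c p q = -fderiv ℝ η y c q p := by
      intro y hy c p q
      have h1 : ∀ p q : E, HasFDerivAt (fun z => η z p q)
          ((evalBilin p q).comp (fderiv ℝ η y)) y := fun p q =>
        (evalBilin p q).hasFDerivAt.comp y (hη.differentiable hn0 y).hasFDerivAt
      have h2 : HasFDerivAt (fun z => η z p q) (-((evalBilin q p).comp (fderiv ℝ η y))) y := by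
        refine (h1 q p).neg.congr_of_eventuallyEq ?_
        filter_upwards [isOpen_ball.mem_nhds hy] with z hz using hanti z hz p q
      exact DFunLike.congr_fun ((h1 p q).unique h2) c
    have hder : ∀ t : ℝ, HasDerivAt (fun t : ℝ => t ^ 2 * η (t • x) a b)
        (2 * t * η (t • x) a b + t ^ 2 * fderiv ℝ η (t • x) x a b) t := by
      intro t
      have h2 : HasDerivAt (fun t : ℝ => η (t • x)) (fderiv ℝ η (t • x) x) t := by
        have h3 : HasDerivAt (fun t : ℝ => t • x) x t := by
          simpa using (hasDerivAt_id t).smul_const x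
        exact (hη.differentiable hn0 (t • x)).hasFDerivAt.comp_hasDerivAt t h3
      have h3 : HasDerivAt (fun t : ℝ => η (t • x) a b) (fderiv ℝ η (t • x) x a b) t :=
        (evalBilin a b).hasFDerivAt.comp_hasDerivAt t h2
      exact ((hasDerivAt_pow 2 t).mul h3).congr_deriv (by simp)
    -- By closedness, the integrand of `dα` is the derivative of `t ↦ t ^ 2 * η (t • x) a b`.
    have hint : ∫ t in (0 : ℝ)..1, (fderiv ℝ g (t, x) (0, a) b - fderiv ℝ g (t, x) (0, b) a) =
        ∫ t in (0 : ℝ)..1, (2 * t * η (t • x) a b + t ^ 2 * fderiv ℝ η (t • x) x a b) := by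
      refine intervalIntegral.integral_congr fun t ht => ?_
      rw [Set.uIcc_of_le zero_le_one] at ht
      have hy := hmem t ht
      simp only [hgd, smul_apply, add_apply, smul_eq_mul]
      have e1 := hclosed _ hy a x b
      have e2 := hantiD _ hy b a x
      have e3 := hanti _ hy a b
      linear_combination t ^ 2 * e1 - t ^ 2 * e2 - t * e3
    rw [hint, intervalIntegral.integral_eq_sub_of_hasDerivAt (fun t _ => hder t)
      (Continuous.intervalIntegrable (by fun_prop) _ _)]
    simp

end Poincare

/-! ### Moser's method and Darboux's theorem in a vector space. -/

section Darboux

open unitInterval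

set_option maxSynthPendingDepth 3

variable {E : Type*} [NormedAddCommGroup E] [NormedSpace ℝ E]

/-- The time-dependent vector field of Moser's method. -/
theorem exists_moser_field [FiniteDimensional ℝ E] {n : ℕ} (hn : 1 ≤ n)
    (J : E ≃L[ℝ] (E →L[ℝ] ℝ)) {η : E → E →L[ℝ] E →L[ℝ] ℝ}
    (hη : ContDiff ℝ n η) (hsmall : ∀ x, ‖(J.symm : (E →L[ℝ] ℝ) →L[ℝ] E).comp (η x)‖ ≤ 1 / 4)
    {α : E → E →L[ℝ] ℝ} (hα : ContDiff ℝ n α) (hα0 : α 0 = 0) (hαd : fderiv ℝ α 0 = 0) :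
    ∃ X : ℝ × E → E, ContDiff ℝ n X ∧ (∀ t, X (t, 0) = 0) ∧
      (∀ t a, fderiv ℝ X (t, 0) (0, a) = 0) ∧
      ∀ t ∈ Set.Icc (0 : ℝ) 1, ∀ x, J (X (t, x)) + t • η x (X (t, x)) = -α x := by
  have hn0 : (n : ℕ∞ω) ≠ 0 := by simp; omega
  have : CompleteSpace E := FiniteDimensional.complete ℝ E
  let Js : (E →L[ℝ] ℝ) →L[ℝ] E := J.symm
  -- On `[0, 1]` one has `θ = 1` and `J (1 - N) = J + t η`. The cut-off keeps `‖N‖ ≤ 2 * (1 / 4) <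
  -- 1` for all real times, so `1 - N` is invertible and the field is defined everywhere.
  let θ : ContDiffBump (0 : ℝ) := ⟨1, 2, by norm_num, by norm_num⟩
  let N : ℝ × E → E →L[ℝ] E := fun p => (-(θ p.1 * p.1)) • Js.comp (η p.2)
  have hN1 : ∀ p, ‖N p‖ < 1 := fun p => by
    have h1 : |θ p.1 * p.1| ≤ 2 := by
      rw [abs_mul, abs_of_nonneg θ.nonneg]
      by_cases hp : p.1 ∈ ball (0 : ℝ) 2
      · rw [mem_ball_zero_iff, Real.norm_eq_abs] at hp
        nlinarith [θ.le_one (x := p.1), θ.nonneg (x := p.1), abs_nonneg p.1]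
      · have : θ p.1 = 0 := θ.zero_of_le_dist (by simpa using hp)
        rw [this]; norm_num
    calc ‖N p‖ = |θ p.1 * p.1| * ‖Js.comp (η p.2)‖ := by rw [norm_smul, norm_neg, Real.norm_eq_abs]
      _ ≤ 2 * (1 / 4) := by gcongr; exact hsmall _
      _ < 1 := by norm_num
  have hN : ContDiff ℝ n N := by
    have h1 : ContDiff ℝ n fun p : ℝ × E => -(θ p.1 * p.1) :=
      ((θ.contDiff.comp contDiff_fst).mul contDiff_fst).neg
    have h2 : ContDiff ℝ n fun p : ℝ × E => Js.comp (η p.2) :=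
      contDiff_const.clm_comp (hη.comp contDiff_snd)
    exact h1.smul h2
  let T : ℝ × E → E →L[ℝ] E := fun p => Ring.inverse (1 - N p)
  have hT : ContDiff ℝ n T := by
    refine contDiff_iff_contDiffAt.2 fun p => ?_
    have h1 : ContDiffAt ℝ n Ring.inverse ((Units.oneSub (N p) (hN1 p) : (E →L[ℝ] E)ˣ) : E →L[ℝ] E) :=
      contDiffAt_ringInverse ℝ _
    exact ContDiffAt.comp p h1 (contDiff_const.sub hN).contDiffAt
  let β : ℝ × E → E := fun p => -Js (α p.2)
  have hβ : ContDiff ℝ n β := (Js.contDiff.comp (hα.comp contDiff_snd)).neg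
  have hβ0 : ∀ t, β (t, 0) = 0 := fun t => by simp [β, hα0]
  refine ⟨fun p => T p (β p), hT.clm_apply hβ, fun t => by simp [hβ0], fun t a => ?_,
    fun t ht x => ?_⟩
  · have h1 : HasFDerivAt (fun p : ℝ × E => α p.2)
        ((fderiv ℝ α 0).comp (ContinuousLinearMap.snd ℝ ℝ E)) (t, 0) :=
      HasFDerivAt.comp (t, (0 : E)) (hα.differentiable hn0 0).hasFDerivAt hasFDerivAt_snd
    have h2 : HasFDerivAt β (0 : ℝ × E →L[ℝ] E) (t, 0) := by
      refine ((Js.hasFDerivAt.comp _ h1).neg).congr_fderiv ?_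
      rw [hαd]; ext <;> simp
    have h3 := ((hT.differentiable hn0 (t, 0)).hasFDerivAt).clm_apply h2
    rw [h3.fderiv]
    simp [hβ0]
  · have h1 : (1 - N (t, x)) (T (t, x) (β (t, x))) = β (t, x) := by
      have : (1 - N (t, x)) * T (t, x) = 1 :=
        Ring.mul_inverse_cancel _ (Units.oneSub (N (t, x)) (hN1 _)).isUnit
      exact DFunLike.congr_fun this (β (t, x))
    have h2 : θ t = 1 := θ.one_of_mem_closedBall (by
      rw [mem_closedBall_zero_iff, Real.norm_eq_abs, abs_of_nonneg ht.1]; exact ht.2)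
    have h3 := congrArg J h1
    simpa [N, β, Js, h2] using h3

/-- The derivative of the pullback of a closed form vanishes along Moser's flow. -/
theorem moser_identity {J : E →L[ℝ] E →L[ℝ] ℝ} {n : ℕ} (hn : 1 ≤ n)
    {η : E → E →L[ℝ] E →L[ℝ] ℝ} (hη : ContDiff ℝ n η) {α : E → E →L[ℝ] ℝ} (hα : ContDiff ℝ n α)
    {X : ℝ × E → E} (hX : ContDiff ℝ n X) {t : ℝ}
    (hXeq : ∀ x, J (X (t, x)) + t • η x (X (t, x)) = -α x) (x a b : E) :
    J (fderiv ℝ X (t, x) (0, a)) b + t * (η x (fderiv ℝ X (t, x) (0, a)) b +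
      fderiv ℝ η x a (X (t, x)) b) = -fderiv ℝ α x a b := by
  have hn0 : (n : ℕ∞ω) ≠ 0 := by simp; omega
  have h1 : HasFDerivAt (fun y : E => X (t, y))
      ((fderiv ℝ X (t, x)).comp (ContinuousLinearMap.inr ℝ ℝ E)) x :=
    ((hX.differentiable hn0 (t, x)).hasFDerivAt).comp x (hasFDerivAt_prodMk_right t x)
  have h2 := ((J.hasFDerivAt.comp x h1).add
    ((((hη.differentiable hn0 x).hasFDerivAt).clm_apply h1).const_smul t)).unique
    (((hα.differentiable hn0 x).hasFDerivAt.neg).congr_of_eventuallyEq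
      (Eventually.of_forall hXeq))
  have h3 := DFunLike.congr_fun (DFunLike.congr_fun h2 a) b
  simp at h3
  linarith

/-- **Moser's method**: a closed two-form `J + η`, with `η` vanishing at the origin, is pulled back
to the constant form `J` by a local diffeomorphism. -/
theorem exists_moser_map [FiniteDimensional ℝ E] {n : ℕ} (hn : 1 ≤ n)
    (J : E ≃L[ℝ] (E →L[ℝ] ℝ)) (hJ : ∀ a b, J a b = -J b a) {η : E → E →L[ℝ] E →L[ℝ] ℝ}
    (hη : ContDiff ℝ n η) (hη0 : η 0 = 0)
    (hsmall : ∀ x, ‖(J.symm : (E →L[ℝ] ℝ) →L[ℝ] E).comp (η x)‖ ≤ 1 / 4)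
    {r : ℝ} (hr : 0 < r) (hanti : ∀ x ∈ ball (0 : E) r, ∀ a b, η x a b = -η x b a)
    (hclosed : ∀ x ∈ ball (0 : E) r, ∀ a b c,
      fderiv ℝ η x a b c - fderiv ℝ η x b a c + fderiv ℝ η x c a b = 0) :
    ∃ δ : E → E, ContDiffAt ℝ n δ 0 ∧ δ 0 = 0 ∧
      fderiv ℝ δ 0 = ContinuousLinearMap.id ℝ E ∧
      ∀ᶠ x in 𝓝 (0 : E), δ x ∈ ball 0 r ∧ ∀ a b, J (fderiv ℝ δ x a) (fderiv ℝ δ x b) +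
        η (δ x) (fderiv ℝ δ x a) (fderiv ℝ δ x b) = J a b := by
  have hn0 : (n : ℕ∞ω) ≠ 0 := by simp; omega
  have : CompleteSpace E := FiniteDimensional.complete ℝ E
  obtain ⟨α, hα, hα0, hαd, hdα⟩ := exists_primitive_twoForm hn hη hanti hclosed
  obtain ⟨X, hX, hX0, hXd, hXeq⟩ := exists_moser_field hn J hη hsmall hα hα0 (hαd hη0)
  obtain ⟨Φ, hΦ, hΦ0, hΦd, hΦx⟩ := exists_flow_of_vanishing hn hX hX0 hXd
  let ev : C(I, E) →L[ℝ] E := ContinuousMap.evalCLM ℝ (1 : I)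
  have hev : ∀ γ : C(I, E), ev γ = γ 1 := fun γ => rfl
  have hδd : ∀ᶠ x in 𝓝 (0 : E), ∀ a, fderiv ℝ (fun x => ev (Φ x)) x a = fderiv ℝ Φ x a 1 := by
    filter_upwards [hΦ.eventually (by simp)] with x hx a
    have hd : HasFDerivAt (fun x => ev (Φ x)) (ev.comp (fderiv ℝ Φ x)) x :=
      ev.hasFDerivAt.comp x (hx.differentiableAt hn0).hasFDerivAt
    rw [hd.fderiv]
    rfl
  refine ⟨fun x => ev (Φ x), ev.contDiff.contDiffAt.comp 0 hΦ, by simp [hΦ0], ?_, ?_⟩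
  · ext a
    rw [hδd.self_of_nhds, hΦd]; rfl
  have hball : ∀ᶠ x in 𝓝 (0 : E), Φ x ∈ ball (0 : C(I, E)) r :=
    hΦ.continuousAt.eventually (by rw [hΦ0]; exact ball_mem_nhds _ hr)
  filter_upwards [hδd, hball, hΦx] with x h1 h2 h3
  obtain ⟨h3a, h3b, h3c⟩ := h3
  have hmem : ∀ t, Φ x t ∈ ball (0 : E) r := fun t => by
    rw [mem_ball_zero_iff] at h2 ⊢
    exact ((Φ x).norm_coe_le_norm t).trans_lt h2
  refine ⟨hmem 1, fun a b => ?_⟩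
  rw [h1, h1, hev]
  let pr : ℝ → I := Set.projIcc 0 1 zero_le_one
  have hpr : Continuous pr := continuous_projIcc
  let y : ℝ → E := fun s => Φ x (pr s)
  let A : ℝ → E := fun s => fderiv ℝ Φ x a (pr s)
  let B : ℝ → E := fun s => fderiv ℝ Φ x b (pr s)
  -- The pullback of `J + s η` by the flow at time `s`, on the vectors `a` and `b`. It is `J a b` at
  -- time `0` and the required value at time `1`, so it suffices that it be constant.
  let q : ℝ → ℝ := fun s => J (A s) (B s) + s * η (y s) (A s) (B s)
  have hηc := hη.continuous
  have hqc : Continuous q := by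
    have hy : Continuous y := (Φ x).continuous.comp hpr
    have hA : Continuous A := (fderiv ℝ Φ x a).continuous.comp hpr
    have hB : Continuous B := (fderiv ℝ Φ x b).continuous.comp hpr
    have hJc : Continuous fun s => J (A s) := J.continuous.comp hA
    exact (hJc.clm_apply hB).add
      (continuous_id.mul (((hηc.comp hy).clm_apply hA).clm_apply hB))
  have hqd : ∀ t ∈ Set.Ioo (0 : ℝ) 1, HasDerivAt q 0 t := by
    intro t ht
    have dy : HasDerivAt y (X (t, y t)) t := h3b t ht
    have dA : HasDerivAt A (fderiv ℝ X (t, y t) (0, A t)) t := (h3c a).2 t ht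
    have dB : HasDerivAt B (fderiv ℝ X (t, y t) (0, B t)) t := (h3c b).2 t ht
    have dJ : HasDerivAt (fun s => J (A s)) (J (fderiv ℝ X (t, y t) (0, A t))) t :=
      (J : E →L[ℝ] E →L[ℝ] ℝ).hasFDerivAt.comp_hasDerivAt t dA
    have dη : HasDerivAt (fun s => η (y s)) (fderiv ℝ η (y t) (X (t, y t))) t :=
      (hη.differentiable hn0 (y t)).hasFDerivAt.comp_hasDerivAt t dy
    have hd := (dJ.clm_apply dB).add ((hasDerivAt_id t).mul ((dη.clm_apply dA).clm_apply dB))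
    refine hd.congr_deriv ?_
    have hXt := hXeq t ⟨ht.1.le, ht.2.le⟩
    have e1 := moser_identity (J := (J : E →L[ℝ] E →L[ℝ] ℝ)) hn hη hα hX hXt (y t) (A t) (B t)
    have e2 := moser_identity (J := (J : E →L[ℝ] E →L[ℝ] ℝ)) hn hη hα hX hXt (y t) (B t) (A t)
    have hyt : y t ∈ ball (0 : E) r := hmem _
    have e3 := hclosed _ hyt (X (t, y t)) (A t) (B t)
    have e4 := hdα _ hyt (A t) (B t)
    have e5 := hanti _ hyt (A t) (fderiv ℝ X (t, y t) (0, B t))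
    have e6 := hJ (A t) (fderiv ℝ X (t, y t) (0, B t))
    simp only [ContinuousLinearEquiv.coe_coe] at e1 e2
    simp only [id, add_apply, one_mul]
    -- Cartan's formula in coordinates: the derivative is `d(ι_X (J + t η)) + η = -dα + η = 0`. Here
    -- `e1` and `e2` differentiate the contraction, `e3` is closedness, `e4` is `dα = η`, and `e5`,
    -- `e6` are antisymmetry.
    linear_combination e1 - e2 + t * e3 - e4 + t * e5 + e6
  obtain ⟨c, hc, hqc'⟩ := exists_hasDerivAt_eq_slope q (fun _ => 0) zero_lt_one hqc.continuousOn hqd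
  have hq : q 1 = q 0 := by
    have : q 1 - q 0 = 0 := by simpa using hqc'.symm
    linarith
  have hp0 : pr 0 = 0 := Set.projIcc_left _
  have hp1 : pr 1 = 1 := Set.projIcc_right _
  simp only [q, A, B, y, hp0, hp1, (h3c a).1, (h3c b).1, one_mul, zero_mul, add_zero] at hq
  exact hq

/-- **Darboux's theorem**, in a vector space. -/
theorem exists_darboux_map [FiniteDimensional ℝ E] {n : ℕ} (hn : 1 ≤ n)
    (J : E ≃L[ℝ] (E →L[ℝ] ℝ)) {W : Set E} (hW : IsOpen W) (h0W : (0 : E) ∈ W)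
    {τ : E → E →L[ℝ] E →L[ℝ] ℝ} (hω : ContDiffOn ℝ n τ W) (hω0 : τ 0 = J)
    (hanti : ∀ x ∈ W, ∀ a b, τ x a b = -τ x b a)
    (hclosed : ∀ x ∈ W, ∀ a b c,
      fderiv ℝ τ x a b c - fderiv ℝ τ x b a c + fderiv ℝ τ x c a b = 0) :
    ∃ δ : E → E, ContDiffAt ℝ n δ 0 ∧ δ 0 = 0 ∧
      fderiv ℝ δ 0 = ContinuousLinearMap.id ℝ E ∧
      ∀ᶠ x in 𝓝 (0 : E), δ x ∈ W ∧
        ∀ a b, τ (δ x) (fderiv ℝ δ x a) (fderiv ℝ δ x b) = J a b := by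
  let Js : (E →L[ℝ] ℝ) →L[ℝ] E := J.symm
  let J' : E →L[ℝ] E →L[ℝ] ℝ := J
  have hcont : ContinuousAt (fun x => ‖Js.comp (τ x - J')‖) 0 := by
    have h1 : ContinuousAt τ 0 := hω.continuousOn.continuousAt (hW.mem_nhds h0W)
    have h2 : ContinuousAt (fun x => Js.comp (τ x - J')) 0 :=
      continuousAt_const.clm_comp (h1.sub continuousAt_const)
    exact h2.norm
  have hev : ∀ᶠ x in 𝓝 (0 : E), x ∈ W ∧ ‖Js.comp (τ x - J')‖ < 1 / 4 :=
    (hW.eventually_mem h0W).and (hcont.eventually (gt_mem_nhds (by simp [hω0, J'])))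
  obtain ⟨s, hs, hsub⟩ := Metric.nhds_basis_closedBall.eventually_iff.1 hev
  -- Cutting off `τ - J` makes the smallness bound global. Closedness is kept only on the ball of
  -- radius `s / 2`, which is enough.
  let χ : ContDiffBump (0 : E) := ⟨s / 2, s, by linarith, by linarith⟩
  let η : E → E →L[ℝ] E →L[ℝ] ℝ := fun x => χ x • (τ x - J')
  have hη : ContDiff ℝ n η := by
    refine contDiff_iff_contDiffAt.2 fun x => ?_
    by_cases hx : x ∈ W
    · exact χ.contDiffAt.smul ((hω.contDiffAt (hW.mem_nhds hx)).sub contDiffAt_const)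
    · have hx' : x ∉ closedBall (0 : E) s := fun h => hx (hsub h).1
      refine (contDiffAt_const (c := (0 : E →L[ℝ] E →L[ℝ] ℝ))).congr_of_eventuallyEq ?_
      filter_upwards [isClosed_closedBall.isOpen_compl.mem_nhds hx'] with y hy
      have : χ y = 0 := χ.zero_of_le_dist (le_of_lt (by simpa using hy))
      simp [η, this]
  have hητ : ∀ x ∈ ball (0 : E) (s / 2), η x = τ x - J' := fun x hx => by
    simp [η, χ.one_of_mem_closedBall (ball_subset_closedBall hx)]
  have hmemW : ∀ x ∈ ball (0 : E) (s / 2), x ∈ W := fun x hx =>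
    (hsub (ball_subset_closedBall (ball_subset_ball (by linarith) hx))).1
  have hJ : ∀ a b, J a b = -J b a := fun a b => by
    have := hanti 0 h0W a b
    rwa [hω0] at this
  have hηd : ∀ x ∈ ball (0 : E) (s / 2), fderiv ℝ η x = fderiv ℝ τ x := fun x hx => by
    have : η =ᶠ[𝓝 x] fun y => τ y - J' := by
      filter_upwards [isOpen_ball.mem_nhds hx] with y hy using hητ y hy
    rw [this.fderiv_eq, fderiv_sub_const]
  obtain ⟨δ, h1, h2, h3, h4⟩ := exists_moser_map hn J hJ hη (by simp [η, hω0, J']) (fun x => by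
      by_cases hx : x ∈ closedBall (0 : E) s
      · have : (J.symm : (E →L[ℝ] ℝ) →L[ℝ] E).comp (η x) = χ x • Js.comp (τ x - J') := by
          ext; simp [η, Js]
        rw [this, norm_smul, Real.norm_of_nonneg χ.nonneg]
        exact (mul_le_of_le_one_left (norm_nonneg _) χ.le_one).trans (hsub hx).2.le
      · have : χ x = 0 := χ.zero_of_le_dist (le_of_lt (by simpa using hx))
        simp [η, this]) (r := s / 2) (by linarith)
    (fun x hx a b => by
      rw [hητ x hx]
      have e1 := hanti x (hmemW x hx) a b
      have e2 := hJ a b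
      simp only [J', sub_apply, ContinuousLinearEquiv.coe_coe]
      linarith)
    (fun x hx a b c => by rw [hηd x hx]; exact hclosed x (hmemW x hx) a b c)
  refine ⟨δ, h1, h2, h3, ?_⟩
  filter_upwards [h4] with x hx
  refine ⟨hmemW _ hx.1, fun a b => ?_⟩
  have := hx.2 a b
  rw [hητ _ hx.1] at this
  simpa [J'] using this

end Darboux

/-! ### Pullback of two-forms. -/

section Pullback

variable {E : Type*} [NormedAddCommGroup E] [NormedSpace ℝ E]
  {M : Type*} [TopologicalSpace M] [ChartedSpace E M]
  {N : Type*} [TopologicalSpace N] [ChartedSpace E N]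
  {N' : Type*} [TopologicalSpace N'] [ChartedSpace E N']

/-- The pullback of a two-form by a map, at a point. -/
noncomputable def TwoForm.pullback (Ω : TwoForm E M) (G : N → M) (x : N) : E [⋀^Fin 2]→L[ℝ] ℝ :=
  (Ω (G x)).compContinuousLinearMap (mfderiv 𝓘(ℝ, E) 𝓘(ℝ, E) G x)

theorem TwoForm.pullback_apply (Ω : TwoForm E M) (G : N → M) (x : N) (v : Fin 2 → E) :
    Ω.pullback G x v = Ω (G x) (fun i => mfderiv 𝓘(ℝ, E) 𝓘(ℝ, E) G x (v i)) := rfl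

/-- Values are compared on vectors of `E`, because the forms at `G x` and `G' x` live on tangent
spaces that agree only after unfolding. -/
theorem TwoForm.pullback_congr (Ω : TwoForm E M) {G G' : N → M} {x : N} (h : G =ᶠ[𝓝 x] G') :
    Ω.pullback G x = Ω.pullback G' x := by
  ext v
  have h1 : mfderiv 𝓘(ℝ, E) 𝓘(ℝ, E) G x = (mfderiv 𝓘(ℝ, E) 𝓘(ℝ, E) G' x : _) := h.mfderiv_eq
  have h2 : ∀ z z' : M, z = z' → ∀ w : Fin 2 → E,
      (Ω z : E [⋀^Fin 2]→L[ℝ] ℝ) w = (Ω z' : E [⋀^Fin 2]→L[ℝ] ℝ) w := by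
    rintro z _ rfl w; rfl
  have h3 : ∀ u : E, (mfderiv 𝓘(ℝ, E) 𝓘(ℝ, E) G x u : E) = mfderiv 𝓘(ℝ, E) 𝓘(ℝ, E) G' x u :=
    fun u => DFunLike.congr_fun h1 u
  rw [TwoForm.pullback_apply, TwoForm.pullback_apply]
  refine (h2 _ _ h.self_of_nhds _).trans ?_
  exact congrArg (Ω (G' x) : E [⋀^Fin 2]→L[ℝ] ℝ) (funext fun i => h3 (v i))

theorem TwoForm.pullback_comp (Ω : TwoForm E M) {G : N → M} {F : N' → N} {x : N'}
    (hG : MDifferentiableAt 𝓘(ℝ, E) 𝓘(ℝ, E) G (F x))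
    (hF : MDifferentiableAt 𝓘(ℝ, E) 𝓘(ℝ, E) F x) :
    Ω.pullback (G ∘ F) x =
      (Ω.pullback G (F x)).compContinuousLinearMap (mfderiv 𝓘(ℝ, E) 𝓘(ℝ, E) F x) := by
  ext v
  rw [TwoForm.pullback_apply, mfderiv_comp x hG hF]
  rfl

theorem TwoForm.pullback_id (Ω : TwoForm E M) (x : M) : Ω.pullback id x = Ω x := by
  ext v
  rw [TwoForm.pullback_apply, mfderiv_id]
  rfl

theorem PreservesOn.comp {Ω : TwoForm E M} {g h : M → M} {A B : Set M} (hg : PreservesOn Ω g A)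
    (hh : PreservesOn Ω h B) (hAB : Set.MapsTo h B A)
    (hgd : ∀ x ∈ A, MDifferentiableAt 𝓘(ℝ, E) 𝓘(ℝ, E) g x)
    (hhd : ∀ x ∈ B, MDifferentiableAt 𝓘(ℝ, E) 𝓘(ℝ, E) h x) : PreservesOn Ω (g ∘ h) B := by
  intro x hx
  have h1 := Ω.pullback_comp (hgd _ (hAB hx)) (hhd x hx)
  have h2 : Ω.pullback g (h x) = Ω (h x) := hg _ (hAB hx)
  rw [h2] at h1
  exact h1.trans (hh x hx)

theorem Diffeomorph.preservesOn_symm {Ω : TwoForm E M} {k : ℕ} (hk : 1 ≤ k)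
    {f : Diffeomorph 𝓘(ℝ, E) 𝓘(ℝ, E) M M k} (hf : PreservesOn Ω f Set.univ) :
    PreservesOn Ω f.symm Set.univ := by
  have hk0 : (k : ℕ∞ω) ≠ 0 := by simp; omega
  intro y _
  have h1 := Ω.pullback_comp (G := f) (F := f.symm) (x := y)
    (f.contMDiff.mdifferentiableAt hk0) (f.symm.contMDiff.mdifferentiableAt hk0)
  have h2 : Ω.pullback f (f.symm y) = Ω (f.symm y) := hf _ trivial
  have h3 : (f : M → M) ∘ f.symm = id := funext f.apply_symm_apply
  rw [h2, h3, Ω.pullback_id] at h1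
  exact h1.symm

end Pullback

/-! ### Two-forms as bilinear forms. -/

section DarbouxChart

set_option maxSynthPendingDepth 3

variable {E : Type*} [NormedAddCommGroup E] [NormedSpace ℝ E]

/-- The bilinear form associated with an alternating form of degree two. -/
noncomputable def bilinOfAlternating (E : Type*) [NormedAddCommGroup E] [NormedSpace ℝ E] :
    (E [⋀^Fin 2]→L[ℝ] ℝ) →L[ℝ] E →L[ℝ] E →L[ℝ] ℝ :=
  (ContinuousLinearMap.compL ℝ E (E [×1]→L[ℝ] ℝ) (E →L[ℝ] ℝ)
    (continuousMultilinearCurryFin1 ℝ E ℝ : (E [×1]→L[ℝ] ℝ) →L[ℝ] E →L[ℝ] ℝ)).comp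
  (((continuousMultilinearCurryLeftEquiv ℝ (fun _ : Fin 2 => E) ℝ :
    (E [×2]→L[ℝ] ℝ) →L[ℝ] E →L[ℝ] E [×1]→L[ℝ] ℝ)).comp
  (ContinuousAlternatingMap.toContinuousMultilinearMapCLM ℝ))

theorem bilinOfAlternating_apply (B : E [⋀^Fin 2]→L[ℝ] ℝ) (a b : E) :
    bilinOfAlternating E B a b = B ![a, b] := by
  change B (Fin.cons a (Fin.snoc 0 b)) = B ![a, b]
  congr 1
  ext i; fin_cases i <;> rfl

theorem bilinOfAlternating_antisymm (B : E [⋀^Fin 2]→L[ℝ] ℝ) (a b : E) :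
    bilinOfAlternating E B a b = -bilinOfAlternating E B b a := by
  rw [bilinOfAlternating_apply, bilinOfAlternating_apply]
  have h : B (![b, a] ∘ Equiv.swap (0 : Fin 2) 1) = -B ![b, a] :=
    B.map_swap ![b, a] (show (0 : Fin 2) ≠ 1 by decide)
  rw [← h]
  congr 1
  ext i; fin_cases i <;> rfl

/-- Puts closedness into the three-term form required by `exists_primitive_twoForm` and
`exists_darboux_map`. -/
theorem extDeriv_twoForm_apply {B : E → E [⋀^Fin 2]→L[ℝ] ℝ} {y : E} (hB : DifferentiableAt ℝ B y)
    (a b c : E) : extDeriv B y ![a, b, c] =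
      fderiv ℝ (fun y => bilinOfAlternating E (B y)) y a b c -
      fderiv ℝ (fun y => bilinOfAlternating E (B y)) y b a c +
      fderiv ℝ (fun y => bilinOfAlternating E (B y)) y c a b := by
  have h1 : fderiv ℝ (fun y => bilinOfAlternating E (B y)) y =
      (bilinOfAlternating E).comp (fderiv ℝ B y) :=
    ((bilinOfAlternating E).hasFDerivAt.comp y hB.hasFDerivAt).fderiv
  rw [h1]
  simp only [ContinuousLinearMap.comp_apply, bilinOfAlternating_apply, extDeriv,
    ContinuousAlternatingMap.alternatizeUncurryFin_apply]
  have e0 : (0 : Fin 3).removeNth ![a, b, c] = ![b, c] := by ext i; fin_cases i <;> rfl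
  have e1 : (1 : Fin 3).removeNth ![a, b, c] = ![a, c] := by ext i; fin_cases i <;> rfl
  have e2 : (2 : Fin 3).removeNth ![a, b, c] = ![a, b] := by ext i; fin_cases i <;> rfl
  refine (Fin.sum_univ_three _).trans ?_
  rw [e0, e1, e2]
  simp
  ring

/-- A nondegenerate bilinear form on a finite-dimensional space is an isomorphism to the dual. -/
theorem exists_equiv_of_nondegenerate [FiniteDimensional ℝ E] {B : E →L[ℝ] E →L[ℝ] ℝ}
    (hB : ∀ v, (∀ w, B v w = 0) → v = 0) :
    ∃ J : E ≃L[ℝ] (E →L[ℝ] ℝ), (J : E →L[ℝ] E →L[ℝ] ℝ) = B := by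
  have hinj : Function.Injective (B : E →ₗ[ℝ] (E →L[ℝ] ℝ)) := by
    refine (injective_iff_map_eq_zero _).2 fun v hv => hB v fun w => ?_
    exact DFunLike.congr_fun hv w
  have hdim : Module.finrank ℝ E = Module.finrank ℝ (E →L[ℝ] ℝ) := by
    rw [← (LinearMap.toContinuousLinearMap (𝕜 := ℝ) (E := E) (F' := ℝ)).finrank_eq]
    exact (Subspace.dual_finrank_eq (K := ℝ) (V := E)).symm
  refine ⟨(LinearMap.linearEquivOfInjective (B : E →ₗ[ℝ] (E →L[ℝ] ℝ)) hinj
    hdim).toContinuousLinearEquiv, ?_⟩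
  ext v w
  rfl

end DarbouxChart

/-! ### Darboux charts on a manifold. -/

section DarbouxChart

set_option maxSynthPendingDepth 3

variable {E : Type*} [NormedAddCommGroup E] [NormedSpace ℝ E] [FiniteDimensional ℝ E]
  {M : Type*} [TopologicalSpace M] [ChartedSpace E M] [IsManifold 𝓘(ℝ, E) ∞ M]

/-- A symplectic form is locally the pullback of a constant form under a `C^k` parametrization. -/
theorem TwoForm.IsSymplectic.exists_darboux_parametrization {Ω : TwoForm E M}
    (hΩ : Ω.IsSymplectic) {k : ℕ} (hk : 1 ≤ k) (p : M) :
    ∃ (J : E ≃L[ℝ] (E →L[ℝ] ℝ)) (e : OpenPartialHomeomorph E E), (∀ a b, J a b = -J b a) ∧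
      (0 : E) ∈ e.source ∧ e 0 = chartAt E p p ∧
      ∀ x ∈ e.source, ContDiffAt ℝ k e x ∧ ContDiffAt ℝ k e.symm (e x) ∧
        e x ∈ (chartAt E p).target ∧ ∀ a b, bilinOfAlternating E (Ω.inChart (chartAt E p) (e x))
          (fderiv ℝ e x a) (fderiv ℝ e x b) = J a b := by
  have hk0 : (k : ℕ∞ω) ≠ 0 := by simp; omega
  have : CompleteSpace E := FiniteDimensional.complete ℝ E
  set φ := chartAt E p with hφ
  have hφmax : φ ∈ IsManifold.maximalAtlas 𝓘(ℝ, E) ∞ M := IsManifold.chart_mem_maximalAtlas p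
  set c := φ p with hc
  have hct : c ∈ φ.target := mem_chart_target E p
  let τ : E → E →L[ℝ] E →L[ℝ] ℝ := fun x => bilinOfAlternating E (Ω.inChart φ (c + x))
  let W : Set E := (fun x => c + x) ⁻¹' φ.target
  have hW : IsOpen W := φ.open_target.preimage (by fun_prop)
  have h0W : (0 : E) ∈ W := by simpa [W] using hct
  have hsm := hΩ.smooth φ hφmax
  -- Regularity is lowered to `k`: Moser's method is carried out at finite order, so the Darboux
  -- chart is only asserted to be of class `C^k`.
  have hτ : ContDiffOn ℝ k τ W := by
    have h1 : ContDiffOn ℝ k (Ω.inChart φ) φ.target := hsm.of_le (by exact_mod_cast le_top)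
    exact (bilinOfAlternating E).contDiff.comp_contDiffOn
      (h1.comp (by fun_prop : ContDiff ℝ k fun x => c + x).contDiffOn fun x hx => hx)
  have hmd : φ.MDifferentiable 𝓘(ℝ, E) 𝓘(ℝ, E) := by
    have : IsManifold 𝓘(ℝ, E) 1 M := IsManifold.of_le (n := ∞) (by norm_num)
    exact mdifferentiable_chart p
  have hnd : ∀ v, (∀ w, bilinOfAlternating E (Ω.inChart φ c) v w = 0) → v = 0 := by
    intro v hv
    have hbij : Function.Bijective (mfderiv 𝓘(ℝ, E) 𝓘(ℝ, E) φ.symm c) :=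
      hmd.symm.mfderiv_bijective (x := c) hct
    refine hbij.1 (Eq.trans ?_ (map_zero (mfderiv 𝓘(ℝ, E) 𝓘(ℝ, E) φ.symm c)).symm)
    refine hΩ.nondegenerate _ _ fun w => ?_
    obtain ⟨w, rfl⟩ := hbij.2 w
    have h1 : Ω.inChart φ c ![v, w] = 0 :=
      (bilinOfAlternating_apply (Ω.inChart φ c) v w).symm.trans (hv w)
    rw [← h1]
    change Ω (φ.symm c) _ = Ω (φ.symm c) _
    congr 1
    ext i; fin_cases i <;> rfl
  obtain ⟨J, hJ⟩ := exists_equiv_of_nondegenerate hnd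
  obtain ⟨δ, hδ, hδ0, hδd, hδx⟩ := exists_darboux_map hk J hW h0W hτ (by simp [τ, hJ])
    (fun x _ a b => bilinOfAlternating_antisymm _ a b) (fun x hx a b d => by
      have h1 : DifferentiableAt ℝ (Ω.inChart φ) (c + x) :=
        (hsm.contDiffAt (φ.open_target.mem_nhds hx)).differentiableAt (by simp)
      have h2 := extDeriv_twoForm_apply h1 a b d
      rw [hΩ.closed φ hφmax _ hx] at h2
      have h3 : fderiv ℝ τ x = fderiv ℝ (fun y => bilinOfAlternating E (Ω.inChart φ y)) (c + x) :=
        fderiv_comp_add_left (f := fun y => bilinOfAlternating E (Ω.inChart φ y)) c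
      rw [h3, ← h2]; rfl)
  have hδc : ContDiffAt ℝ k (fun x => c + δ x) 0 := contDiffAt_const.add hδ
  have hfd : ∀ x, fderiv ℝ (fun x => c + δ x) x = fderiv ℝ δ x := fun x => fderiv_const_add c
  have hd0 : HasFDerivAt (fun x => c + δ x)
      ((ContinuousLinearEquiv.refl ℝ E : E ≃L[ℝ] E) : E →L[ℝ] E) 0 := by
    have := (hδc.differentiableAt hk0).hasFDerivAt
    rwa [hfd, hδd] at this
  -- Invertibility of the derivative on a whole neighbourhood is what makes the inverse `C^k` at
  -- every point of the chart, not only at the centre.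
  have hinv : ∀ᶠ x in 𝓝 (0 : E), fderiv ℝ (fun x => c + δ x) x ∈
      Set.range ((↑) : (E ≃L[ℝ] E) → E →L[ℝ] E) := by
    have h1 : ContinuousAt (fderiv ℝ (fun x => c + δ x)) 0 :=
      (hδc.fderiv_right (m := 0) (by exact_mod_cast hk)).continuousAt
    refine h1.eventually ?_
    rw [hd0.fderiv]
    exact ContinuousLinearEquiv.nhds _
  obtain ⟨S, hS, hSo, h0S⟩ := _root_.eventually_nhds_iff.1
    ((hinv.and (hδc.eventually (by simp))).and hδx)
  let e := (hδc.toOpenPartialHomeomorph _ hd0 hk0).restrOpen S hSo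
  have hecoe : (e : E → E) = fun x => c + δ x := rfl
  have h0e : (0 : E) ∈ e.source := ⟨hδc.mem_toOpenPartialHomeomorph_source hd0 hk0, h0S⟩
  refine ⟨J, e, fun a b => ?_, h0e, by simp [hecoe, hδ0], fun x hx => ?_⟩
  · have : ∀ a b, J a b = bilinOfAlternating E (Ω.inChart φ c) a b := fun a b => by
      rw [← hJ]; rfl
    rw [this, this]; exact bilinOfAlternating_antisymm _ a b
  · obtain ⟨⟨⟨f', hf'⟩, h2⟩, h3, h4⟩ := hS x hx.2
    refine ⟨h2, ?_, h3, fun a b => ?_⟩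
    · refine e.contDiffAt_symm (e.map_source hx) (f₀' := f') ?_ ?_
      · rw [e.left_inv hx, hf']
        exact (h2.differentiableAt hk0).hasFDerivAt
      · rw [e.left_inv hx]; exact h2
    · rw [← h4 a b, hecoe, hfd]

/-- **Darboux charts**: near any point there is a `C^k` chart in which the symplectic form is
constant. -/
theorem TwoForm.IsSymplectic.exists_darboux_chart {Ω : TwoForm E M}
    (hΩ : Ω.IsSymplectic) {k : ℕ} (hk : 1 ≤ k) (p : M) :
    ∃ D : OpenPartialHomeomorph M E, p ∈ D.source ∧
      ContMDiffOn 𝓘(ℝ, E) 𝓘(ℝ, E) k D D.source ∧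
      ContMDiffOn 𝓘(ℝ, E) 𝓘(ℝ, E) k D.symm D.target ∧
      ∃ J : E ≃L[ℝ] (E →L[ℝ] ℝ), (∀ a b, J a b = -J b a) ∧
        ∀ y ∈ D.target, ∀ a b, bilinOfAlternating E (Ω.inChart D y) a b = J a b := by
  have hk0 : (k : ℕ∞ω) ≠ 0 := by simp; omega
  have : IsManifold 𝓘(ℝ, E) k M := IsManifold.of_le (n := ∞) (by exact_mod_cast le_top)
  obtain ⟨J, e, hJ, h0e, he0, he⟩ := hΩ.exists_darboux_parametrization hk p
  set φ := chartAt E p with hφ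
  have hφmax : φ ∈ IsManifold.maximalAtlas 𝓘(ℝ, E) k M := IsManifold.chart_mem_maximalAtlas p
  refine ⟨φ.trans e.symm, ?_, ?_, ?_, J, hJ, ?_⟩
  · rw [OpenPartialHomeomorph.trans_source]
    refine ⟨mem_chart_source E p, ?_⟩
    change φ p ∈ e.target
    rw [← he0]; exact e.map_source h0e
  · intro y hy
    rw [OpenPartialHomeomorph.trans_source] at hy
    have h1 : ContMDiffAt 𝓘(ℝ, E) 𝓘(ℝ, E) k φ y := contMDiffAt_of_mem_maximalAtlas hφmax hy.1
    have hy2 : φ y ∈ e.target := hy.2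
    have h2 : ContDiffAt ℝ k e.symm (φ y) := by
      have := (he (e.symm (φ y)) (e.map_target hy2)).2.1
      rwa [e.right_inv hy2] at this
    exact (h2.contMDiffAt.comp y h1).contMDiffWithinAt
  · intro x hx
    rw [OpenPartialHomeomorph.trans_target] at hx
    have hx1 : x ∈ e.source := hx.1
    have h1 : ContMDiffAt 𝓘(ℝ, E) 𝓘(ℝ, E) k φ.symm (e x) :=
      contMDiffAt_symm_of_mem_maximalAtlas hφmax (he x hx1).2.2.1
    exact (h1.comp x (he x hx1).1.contMDiffAt).contMDiffWithinAt
  · intro x hx a b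
    rw [OpenPartialHomeomorph.trans_target] at hx
    have hx1 : x ∈ e.source := hx.1
    obtain ⟨h1, -, h3, h4⟩ := he x hx1
    have h5 : MDifferentiableAt 𝓘(ℝ, E) 𝓘(ℝ, E) φ.symm (e x) :=
      (contMDiffAt_symm_of_mem_maximalAtlas hφmax h3).mdifferentiableAt hk0
    have h6 := Ω.pullback_comp (F := e) h5 (h1.contMDiffAt.mdifferentiableAt hk0)
    have h7 : Ω.inChart (φ.trans e.symm) x =
        (Ω.inChart φ (e x)).compContinuousLinearMap (fderiv ℝ e x) := by
      rw [← mfderiv_eq_fderiv]; exact h6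
    rw [← h4 a b, h7, bilinOfAlternating_apply, bilinOfAlternating_apply]
    change Ω.inChart φ (e x) _ = Ω.inChart φ (e x) _
    congr 1
    ext i; fin_cases i <;> rfl

end DarbouxChart

/-! ### `C^k` convergence on manifolds. -/

section ManifoldConvergence

theorem tendsto_chart_symm {ι E M : Type*} [NormedAddCommGroup E] [TopologicalSpace M]
    (l : Filter ι) {φ : OpenPartialHomeomorph M E} {y : M}
    (hy : y ∈ φ.source) :
    Tendsto (fun p : ι × E => (p.1, φ.symm p.2)) (l ×ˢ 𝓝 (φ y)) (l ×ˢ 𝓝 y) :=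
  tendsto_fst.prodMk ((φ.tendsto_symm hy).comp tendsto_snd)

theorem tendsto_chart {ι E M : Type*} [NormedAddCommGroup E] [TopologicalSpace M]
    (l : Filter ι) {φ : OpenPartialHomeomorph M E} {y : M}
    (hy : y ∈ φ.source) :
    Tendsto (fun p : ι × M => (p.1, φ p.2)) (l ×ˢ 𝓝 y) (l ×ˢ 𝓝 (φ y)) :=
  tendsto_fst.prodMk ((φ.continuousAt hy).tendsto.comp tendsto_snd)

variable {ι E : Type*} [NormedAddCommGroup E] [NormedSpace ℝ E]
  {M : Type*} [TopologicalSpace M] [ChartedSpace E M] {k : ℕ} {l : Filter ι}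

/-- The maps `H i` converge along `l` to `f`, uniformly near `y` in the `C^k` sense, when read in
charts. -/
structure MConv (E : Type*) [NormedAddCommGroup E] [NormedSpace ℝ E] [ChartedSpace E M]
    (k : ℕ) (l : Filter ι) (H : ι → M → M) (f : M → M) (y : M) : Prop where
  tendsto : Tendsto (fun p : ι × M => H p.1 p.2) (l ×ˢ 𝓝 y) (𝓝 (f y))
  ckConv : ∀ φ ∈ IsManifold.maximalAtlas 𝓘(ℝ, E) k M, ∀ ψ ∈ IsManifold.maximalAtlas 𝓘(ℝ, E) k M,
    y ∈ φ.source → f y ∈ ψ.source → CkConv k l (fun i => ψ ∘ H i ∘ φ.symm) (ψ ∘ f ∘ φ.symm) (φ y)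

theorem contDiffAt_in_charts [IsManifold 𝓘(ℝ, E) k M] {f : M → M}
    {φ ψ : OpenPartialHomeomorph M E} (hφ : φ ∈ IsManifold.maximalAtlas 𝓘(ℝ, E) k M)
    (hψ : ψ ∈ IsManifold.maximalAtlas 𝓘(ℝ, E) k M) {z : E} (hz : z ∈ φ.target)
    (hf : ContMDiffAt 𝓘(ℝ, E) 𝓘(ℝ, E) k f (φ.symm z)) (hfz : f (φ.symm z) ∈ ψ.source) :
    ContDiffAt ℝ k (ψ ∘ f ∘ φ.symm) z :=
  contMDiffAt_iff_contDiffAt.1 ((contMDiffAt_of_mem_maximalAtlas hψ hfz).comp z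
    (hf.comp z (contMDiffAt_symm_of_mem_maximalAtlas hφ hz)))

namespace MConv

theorem congr {H H' : ι → M → M} {f : M → M} {y : M} (h : MConv E k l H f y)
    (hH : ∀ᶠ p in l ×ˢ 𝓝 y, H p.1 p.2 = H' p.1 p.2) : MConv E k l H' f y := by
  refine ⟨h.tendsto.congr' hH, fun φ hφ ψ hψ hy hfy => ?_⟩
  refine (h.ckConv φ hφ ψ hψ hy hfy).congr ?_ EventuallyEq.rfl
  filter_upwards [(tendsto_chart_symm l hy).eventually hH] with p hp
  simp [hp]

variable [IsManifold 𝓘(ℝ, E) k M]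

/-- Convergence may be checked in a single pair of charts. -/
theorem of_charts {H : ι → M → M} {f : M → M} {y : M}
    {φ ψ : OpenPartialHomeomorph M E} (hφ : φ ∈ IsManifold.maximalAtlas 𝓘(ℝ, E) k M)
    (hψ : ψ ∈ IsManifold.maximalAtlas 𝓘(ℝ, E) k M) (hy : y ∈ φ.source) (hfy : f y ∈ ψ.source)
    (hf : ContinuousAt f y) (hH : ∀ᶠ p in l ×ˢ 𝓝 y, H p.1 p.2 ∈ ψ.source)
    (hc : CkConv k l (fun i => ψ ∘ H i ∘ φ.symm) (ψ ∘ f ∘ φ.symm) (φ y)) : MConv E k l H f y := by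
  -- `hH` is needed to recover `H` from its chart expression, since `ψ` carries no information
  -- outside its source.
  have hT : Tendsto (fun p : ι × M => H p.1 p.2) (l ×ˢ 𝓝 y) (𝓝 (f y)) := by
    have h1 := hc.tendsto.comp (tendsto_chart l hy)
    have h2 : (ψ ∘ f ∘ φ.symm) (φ y) = ψ (f y) := by simp [φ.left_inv hy]
    rw [h2] at h1
    refine ((ψ.tendsto_symm hfy).comp h1).congr' ?_
    filter_upwards [hH, (φ.open_source.eventually_mem hy).prod_inr l] with p h3 h4
    simp [φ.left_inv h4, ψ.left_inv h3]
  refine ⟨hT, fun φ' hφ' ψ' hψ' hy' hfy' => ?_⟩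
  have hφφ : ContDiffAt ℝ k (φ ∘ id ∘ φ'.symm) (φ' y) :=
    contDiffAt_in_charts hφ' hφ (φ'.map_source hy') contMDiffAt_id (by simpa [φ'.left_inv hy'])
  have hψψ : ContDiffAt ℝ k (ψ' ∘ id ∘ ψ.symm) (ψ (f y)) :=
    contDiffAt_in_charts hψ hψ' (ψ.map_source hfy) contMDiffAt_id (by simpa [ψ.left_inv hfy])
  have e1 : (φ ∘ id ∘ φ'.symm) (φ' y) = φ y := by simp [φ'.left_inv hy']
  have e2 : (ψ ∘ f ∘ φ.symm) (φ y) = ψ (f y) := by simp [φ.left_inv hy]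
  have h1 := CkConv.comp (e1 ▸ hc) (CkConv.const (l := l) hφφ)
  have h2 := CkConv.comp (CkConv.const (l := l)
    (show ContDiffAt ℝ k _ (((ψ ∘ f ∘ φ.symm) ∘ (φ ∘ id ∘ φ'.symm)) (φ' y)) by
      rw [Function.comp_apply, e1, e2]; exact hψψ)) h1
  have hs : ∀ᶠ p in l ×ˢ 𝓝 (φ' y), φ'.symm p.2 ∈ φ.source ∧ H p.1 (φ'.symm p.2) ∈ ψ.source :=
    (tendsto_chart_symm l hy').eventually
      (((φ.open_source.eventually_mem hy).prod_inr l).and hH)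
  have hs' : ∀ᶠ z in 𝓝 (φ' y), φ'.symm z ∈ φ.source ∧ f (φ'.symm z) ∈ ψ.source :=
    (φ'.tendsto_symm hy').eventually
      ((φ.open_source.eventually_mem hy).and (hf.eventually (ψ.open_source.eventually_mem hfy)))
  refine h2.congr (hs.mono fun p hp => ?_) (hs'.mono fun z hz => ?_)
  · simp [φ.left_inv hp.1, ψ.left_inv hp.2]
  · simp [φ.left_inv hz.1, ψ.left_inv hz.2]

theorem const {f : M → M} {y : M} (hf : ContMDiffAt 𝓘(ℝ, E) 𝓘(ℝ, E) k f y) :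
    MConv E k l (fun _ => f) f y := by
  refine ⟨hf.continuousAt.tendsto.comp tendsto_snd, fun φ hφ ψ hψ hy hfy => CkConv.const ?_⟩
  exact contDiffAt_in_charts hφ hψ (φ.map_source hy) (by rwa [φ.left_inv hy])
    (by rwa [φ.left_inv hy])

theorem comp {G : ι → M → M} {g : M → M} {F : ι → M → M} {f : M → M} {y : M}
    (hG : MConv E k l G g (f y)) (hF : MConv E k l F f y) (hf : ContinuousAt f y) :
    MConv E k l (fun i => G i ∘ F i) (g ∘ f) y := by
  have hT : Tendsto (fun p : ι × M => (p.1, F p.1 p.2)) (l ×ˢ 𝓝 y) (l ×ˢ 𝓝 (f y)) :=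
    tendsto_fst.prodMk hF.tendsto
  refine ⟨hG.tendsto.comp hT, fun φ hφ ψ hψ hy hgy => ?_⟩
  set θ := chartAt E (f y) with hθ
  have hθm : θ ∈ IsManifold.maximalAtlas 𝓘(ℝ, E) k M := IsManifold.chart_mem_maximalAtlas _
  have hfy : f y ∈ θ.source := mem_chart_source E (f y)
  have e1 : (θ ∘ f ∘ φ.symm) (φ y) = θ (f y) := by simp [φ.left_inv hy]
  have h1 := hF.ckConv φ hφ θ hθm hy hfy
  have h2 := hG.ckConv θ hθm ψ hψ hfy hgy
  refine (CkConv.comp (e1 ▸ h2) h1).congr ?_ ?_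
  · filter_upwards [(tendsto_chart_symm l hy).eventually
      (hF.tendsto.eventually (θ.open_source.eventually_mem hfy))] with p hp
    simp [θ.left_inv hp]
  · filter_upwards [(φ.tendsto_symm hy).eventually
      (hf.eventually (θ.open_source.eventually_mem hfy))] with z hz
    simp [θ.left_inv hz]

end MConv

/-- A closed ball in a chart is a compact neighbourhood, so boxes over it control all nearby points.
A box compares `g` with `f` at the same point; continuity of the derivatives of `f` turns this into
joint convergence. -/
theorem mConv_of_le_ckNhds [FiniteDimensional ℝ E] [IsManifold 𝓘(ℝ, E) ∞ M] {f : M → M}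
    {U : Set M} (hU : IsOpen U) {l : Filter (M → M)} (hl : l ≤ ckNhds E k f U)
    (hf : ∀ y ∈ U, ContMDiffAt 𝓘(ℝ, E) 𝓘(ℝ, E) k f y)
    (hg : ∀ᶠ g in l, ∀ y ∈ U, ContMDiffAt 𝓘(ℝ, E) 𝓘(ℝ, E) k g y) {y : M} (hy : y ∈ U) :
    MConv E k l (fun g => g) f y := by
  have : IsManifold 𝓘(ℝ, E) k M := IsManifold.of_le (n := ∞) (by exact_mod_cast le_top)
  have : ProperSpace E := FiniteDimensional.proper ℝ E
  set φ := chartAt E y with hφ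
  set ψ := chartAt E (f y) with hψ
  have hys : y ∈ φ.source := mem_chart_source E y
  have hfys : f y ∈ ψ.source := mem_chart_source E (f y)
  have hφm : φ ∈ IsManifold.maximalAtlas 𝓘(ℝ, E) k M := IsManifold.chart_mem_maximalAtlas _
  have hψm : ψ ∈ IsManifold.maximalAtlas 𝓘(ℝ, E) k M := IsManifold.chart_mem_maximalAtlas _
  have hnh : ∀ᶠ z in 𝓝 (φ y), z ∈ φ.target ∧ φ.symm z ∈ U ∧ f (φ.symm z) ∈ ψ.source :=
    (φ.open_target.eventually_mem (φ.map_source hys)).and ((φ.tendsto_symm hys).eventually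
      ((hU.eventually_mem hy).and ((hf y hy).continuousAt.eventually (ψ.open_source.eventually_mem hfys))))
  obtain ⟨r, hr, hrs⟩ := nhds_basis_closedBall.eventually_iff.1 hnh
  set K := φ.symm '' closedBall (φ y) r with hK
  have hKc : IsCompact K := (isCompact_closedBall _ _).image_of_continuousOn
    (φ.continuousOn_symm.mono fun z hz => (hrs hz).1)
  have hbox : ∀ ε : ℝ, 0 < ε → ∀ᶠ g in l, g ∈ ckBox k f φ ψ K ε := fun ε hε => by
    refine hl (mem_generate_of_mem ⟨φ, IsManifold.chart_mem_maximalAtlas _, ψ,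
      IsManifold.chart_mem_maximalAtlas _, K, ε, hKc, ?_, ?_, ?_, hε, rfl⟩)
    · rintro _ ⟨z, hz, rfl⟩; exact (hrs hz).2.1
    · rintro _ ⟨z, hz, rfl⟩; exact φ.map_target (hrs hz).1
    · rintro _ ⟨z, hz, rfl⟩; exact (hrs hz).2.2
  have hball : ∀ᶠ z in 𝓝 (φ y), z ∈ closedBall (φ y) r := closedBall_mem_nhds _ hr
  have hlim : ContDiffAt ℝ k (ψ ∘ f ∘ φ.symm) (φ y) := contDiffAt_in_charts hφm hψm
    (φ.map_source hys) (by rw [φ.left_inv hys]; exact hf y hy) (by rwa [φ.left_inv hys])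
  refine MConv.of_charts hφm hψm hys hfys (hf y hy).continuousAt ?_ ⟨hlim, ?_, fun s hs => ?_⟩
  · filter_upwards [(hbox 1 one_pos).prod_inl _, (((φ.continuousAt hys).eventually hball).and
      (φ.open_source.eventually_mem hys)).prod_inr l] with p h1 h2
    exact h1.1 ⟨φ p.2, h2.1, φ.left_inv h2.2⟩
  · filter_upwards [((hbox 1 one_pos).and hg).prod_inl _, hball.prod_inr l] with p h1 h2
    exact contDiffAt_in_charts hφm hψm (hrs h2).1 (h1.2 _ (hrs h2).2.1)
      (h1.1.1 ⟨p.2, h2, rfl⟩)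
  · have hcont := (CkConv.const (l := l) hlim).tendsto_iteratedFDeriv s hs
    rw [Metric.tendsto_nhds] at hcont ⊢
    intro ε hε
    filter_upwards [hcont (ε / 2) (half_pos hε), (hbox (ε / 2) (half_pos hε)).prod_inl _,
      hball.prod_inr l] with p h1 h2 h3
    have h4 := h2.2 s hs p.2 ⟨_, ⟨p.2, h3, rfl⟩, φ.right_inv (hrs h3).1⟩
    rw [← dist_eq_norm] at h4
    linarith [dist_triangle (iteratedFDeriv ℝ s (ψ ∘ p.1 ∘ φ.symm) p.2)
      (iteratedFDeriv ℝ s (ψ ∘ f ∘ φ.symm) p.2) (iteratedFDeriv ℝ s (ψ ∘ f ∘ φ.symm) (φ y))]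

/-- Pointwise-local convergence becomes uniform on a compact `K`, for the finitely many orders up to
`k`. `MConv` tests all `C^k` charts, in particular the smooth ones that generate `ckNhds`. -/
theorem tendsto_ckNhds [IsManifold 𝓘(ℝ, E) ∞ M] {H : ι → M → M} {f : M → M}
    (h : ∀ y, MConv E k l H f y) : Tendsto H l (ckNhds E k f Set.univ) := by
  have hk : (k : ℕ∞ω) ≤ ∞ := by exact_mod_cast le_top
  refine le_generate_iff.2 ?_
  rintro _ ⟨φ, hφ, ψ, hψ, K, ε, hK, -, hKφ, hKψ, hε, rfl⟩
  have hc : ∀ y ∈ K, CkConv k l (fun i => ψ ∘ H i ∘ φ.symm) (ψ ∘ f ∘ φ.symm) (φ y) :=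
    fun y hy => (h y).ckConv φ (IsManifold.maximalAtlas_subset_of_le hk hφ) ψ
      (IsManifold.maximalAtlas_subset_of_le hk hψ) (hKφ hy) (hKψ hy)
  have h1 : ∀ᶠ i in l, ∀ y ∈ K, H i y ∈ ψ.source := hK.eventually_forall_of_prod_nhds fun y hy =>
    (h y).tendsto.eventually (ψ.open_source.eventually_mem (hKψ hy))
  have h2 : ∀ᶠ i in l, ∀ r ∈ Set.Iic k, ∀ y ∈ K,
      ‖iteratedFDeriv ℝ r (ψ ∘ H i ∘ φ.symm) (φ y) -
        iteratedFDeriv ℝ r (ψ ∘ f ∘ φ.symm) (φ y)‖ < ε := by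
    refine (eventually_all_finite (Set.finite_Iic k)).2 fun r hr =>
      hK.eventually_forall_of_prod_nhds (P := fun i y =>
        ‖iteratedFDeriv ℝ r (ψ ∘ H i ∘ φ.symm) (φ y) -
        iteratedFDeriv ℝ r (ψ ∘ f ∘ φ.symm) (φ y)‖ < ε) fun y hy => ?_
    have h3 := ((hc y hy).tendsto_iteratedFDeriv r hr).sub
      ((CkConv.const (l := l) (hc y hy).limit).tendsto_iteratedFDeriv r hr)
    rw [sub_self] at h3
    have h4 := (h3.comp (tendsto_chart l (hKφ hy))).norm
    rw [norm_zero] at h4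
    exact h4.eventually (gt_mem_nhds hε)
  change ∀ᶠ i in l, H i ∈ ckBox k f φ ψ K ε
  filter_upwards [h1, h2] with i h3 h4
  refine ⟨h3, fun r hr => ?_⟩
  rintro _ ⟨y, hy, rfl⟩
  exact h4 r hr y hy

end ManifoldConvergence

/-! ### Transplanting maps from a chart to the manifold. -/

section Transplant

variable {E : Type*} [NormedAddCommGroup E] {M : Type*} [TopologicalSpace M]

open scoped Classical in
/-- The map of `M` that is given by `P` in the chart `D` and is the identity elsewhere. -/
noncomputable def OpenPartialHomeomorph.transplant (D : OpenPartialHomeomorph M E) (P : E → E)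
    (y : M) : M :=
  if y ∈ D.source then D.symm (P (D y)) else y

namespace OpenPartialHomeomorph

variable {D : OpenPartialHomeomorph M E} {P Q : E → E} {C : Set E}

theorem transplant_of_mem {y : M} (hy : y ∈ D.source) :
    D.transplant P y = D.symm (P (D y)) := if_pos hy

theorem transplant_of_notMem {y : M} (hy : y ∉ D.source) : D.transplant P y = y := if_neg hy

theorem transplant_of_notMem_image (hP : ∀ x ∉ C, P x = x) {y : M} (hy : y ∉ D.symm '' C) :
    D.transplant P y = y := by
  by_cases h : y ∈ D.source
  · rw [transplant_of_mem h, hP _ fun h1 => hy ⟨D y, h1, D.left_inv h⟩, D.left_inv h]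
  · exact transplant_of_notMem h

/-- If `P x` lies outside `C` it is fixed by `P`, so injectivity gives `P x = x`. -/
theorem mapsTo_target_of_eq_off (hC : C ⊆ D.target) (hP : ∀ x ∉ C, P x = x)
    (hPi : Function.Injective P) : Set.MapsTo P D.target D.target := by
  intro x hx
  by_cases h : P x ∈ C
  · exact hC h
  · rwa [hPi (hP _ h)]

theorem transplant_leftInverse (hQP : Function.LeftInverse Q P)
    (hP : Set.MapsTo P D.target D.target) :
    Function.LeftInverse (D.transplant Q) (D.transplant P) := by
  intro y
  by_cases h : y ∈ D.source
  · have h1 := hP (D.map_source h)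
    rw [transplant_of_mem h, transplant_of_mem (D.map_target h1), D.right_inv h1, hQP,
      D.left_inv h]
  · rw [transplant_of_notMem h, transplant_of_notMem h]

variable [NormedSpace ℝ E] [ChartedSpace E M] {k : ℕ}

/-- Across the boundary of the chart domain the map is locally the identity, because the image of
the compact `C` is closed; this uses that `M` is Hausdorff. -/
theorem contMDiff_transplant [T2Space M] [IsManifold 𝓘(ℝ, E) k M]
    (hD : D ∈ IsManifold.maximalAtlas 𝓘(ℝ, E) k M) (hCc : IsCompact C) (hC : C ⊆ D.target)
    (hP : ∀ x ∉ C, P x = x) (hPt : Set.MapsTo P D.target D.target) (hPk : ContDiff ℝ k P) :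
    ContMDiff 𝓘(ℝ, E) 𝓘(ℝ, E) k (D.transplant P) := by
  intro y
  by_cases h : y ∈ D.source
  · have h1 : D.transplant P =ᶠ[𝓝 y] D.symm ∘ P ∘ D :=
      (D.open_source.eventually_mem h).mono fun z hz => transplant_of_mem hz
    refine ContMDiffAt.congr_of_eventuallyEq ?_ h1
    exact (contMDiffAt_symm_of_mem_maximalAtlas hD (hPt (D.map_source h))).comp y
      (hPk.contMDiff.contMDiffAt.comp y (contMDiffAt_of_mem_maximalAtlas hD h))
  · have hcl : IsClosed (D.symm '' C) :=
      (hCc.image_of_continuousOn (D.continuousOn_symm.mono hC)).isClosed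
    have hy : y ∉ D.symm '' C := by
      rintro ⟨x, hx, rfl⟩; exact h (D.map_target (hC hx))
    have h1 : D.transplant P =ᶠ[𝓝 y] id :=
      (hcl.isOpen_compl.eventually_mem hy).mono fun z hz => transplant_of_notMem_image hP hz
    exact contMDiffAt_id.congr_of_eventuallyEq h1

end OpenPartialHomeomorph

end Transplant

/-! ### Cutting off symplectic maps near a point and near a finite set. -/

section LocalExtension

set_option maxSynthPendingDepth 3

variable {E : Type*} [NormedAddCommGroup E] [NormedSpace ℝ E]
  {M : Type*} [TopologicalSpace M] [ChartedSpace E M]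

theorem bilinOfAlternating_comp (B : E [⋀^Fin 2]→L[ℝ] ℝ) (A : E →L[ℝ] E) (a b : E) :
    bilinOfAlternating E (B.compContinuousLinearMap A) a b =
      bilinOfAlternating E B (A a) (A b) := by
  rw [bilinOfAlternating_apply, bilinOfAlternating_apply]
  change B _ = B _
  congr 1
  ext i; fin_cases i <;> rfl

theorem bilinOfAlternating_ext {B B' : E [⋀^Fin 2]→L[ℝ] ℝ}
    (h : ∀ a b, bilinOfAlternating E B a b = bilinOfAlternating E B' a b) : B = B' := by
  ext v
  have h1 : v = ![v 0, v 1] := by ext i; fin_cases i <;> rfl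
  rw [h1, ← bilinOfAlternating_apply, h, bilinOfAlternating_apply]

variable {k : ℕ} {Ω : TwoForm E M} {D : OpenPartialHomeomorph M E} {J : E →L[ℝ] E →L[ℝ] ℝ}

theorem preservesOn_transplant [T2Space M] [IsManifold 𝓘(ℝ, E) k M] (hk : 1 ≤ k)
    (hD : D ∈ IsManifold.maximalAtlas 𝓘(ℝ, E) k M)
    (hJ : ∀ y ∈ D.target, ∀ a b, bilinOfAlternating E (Ω.inChart D y) a b = J a b)
    {C : Set E} {P : E → E} (hCc : IsCompact C) (hC : C ⊆ D.target)
    (hP : ∀ x ∉ C, P x = x) (hPt : Set.MapsTo P D.target D.target) (hPk : ContDiff ℝ k P)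
    (hPJ : ∀ x a b, J (fderiv ℝ P x a) (fderiv ℝ P x b) = J a b) :
    PreservesOn Ω (D.transplant P) Set.univ := by
  have hk0 : (k : ℕ∞ω) ≠ 0 := by simp; omega
  intro y _
  by_cases h : y ∈ D.source
  · have h1 : D.transplant P =ᶠ[𝓝 y] (D.symm ∘ P) ∘ D := (D.open_source.eventually_mem h).mono
      fun z hz => OpenPartialHomeomorph.transplant_of_mem hz
    have hDy : MDifferentiableAt 𝓘(ℝ, E) 𝓘(ℝ, E) D y :=
      (contMDiffAt_of_mem_maximalAtlas hD h).mdifferentiableAt hk0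
    have hx := D.map_source h
    have hDs : ∀ x ∈ D.target, MDifferentiableAt 𝓘(ℝ, E) 𝓘(ℝ, E) D.symm x := fun x hx =>
      (contMDiffAt_symm_of_mem_maximalAtlas hD hx).mdifferentiableAt hk0
    have hPd : MDifferentiableAt 𝓘(ℝ, E) 𝓘(ℝ, E) P (D y) :=
      hPk.contMDiff.contMDiffAt.mdifferentiableAt hk0
    have h2 : Ω.pullback (D.symm ∘ P) (D y) = Ω.pullback D.symm (D y) := by
      have h3 : Ω.pullback (D.symm ∘ P) (D y) =
          (Ω.inChart D (P (D y))).compContinuousLinearMap (fderiv ℝ P (D y)) := by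
        rw [← mfderiv_eq_fderiv]; exact Ω.pullback_comp (hDs _ (hPt hx)) hPd
      refine bilinOfAlternating_ext fun a b => ?_
      rw [h3, bilinOfAlternating_comp, hJ _ (hPt hx), hPJ]
      exact (hJ _ hx a b).symm
    have h4 : D.symm ∘ D =ᶠ[𝓝 y] id :=
      (D.open_source.eventually_mem h).mono fun z hz => D.left_inv hz
    have h5 : Ω.pullback ((D.symm ∘ P) ∘ D) y = Ω.pullback (D.symm ∘ D) y := by
      rw [Ω.pullback_comp ((hDs _ (hPt hx)).comp _ hPd) hDy, h2, Ω.pullback_comp (hDs _ hx) hDy]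
    exact (Ω.pullback_congr h1).trans (h5.trans ((Ω.pullback_congr h4).trans (Ω.pullback_id y)))
  · have hcl : IsClosed (D.symm '' C) :=
      (hCc.image_of_continuousOn (D.continuousOn_symm.mono hC)).isClosed
    have hy : y ∉ D.symm '' C := by
      rintro ⟨x, hx, rfl⟩; exact h (D.map_target (hC hx))
    have h1 : D.transplant P =ᶠ[𝓝 y] id := (hcl.isOpen_compl.eventually_mem hy).mono
      fun z hz => OpenPartialHomeomorph.transplant_of_notMem_image hP hz
    exact (Ω.pullback_congr h1).trans (Ω.pullback_id y)

/-- A map that preserves a two-form which is constant in the chart `D` preserves this constant form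
when read in `D`. -/
theorem PreservesOn.fderiv_in_chart [IsManifold 𝓘(ℝ, E) k M] (hk : 1 ≤ k)
    (hD : D ∈ IsManifold.maximalAtlas 𝓘(ℝ, E) k M)
    (hJ : ∀ y ∈ D.target, ∀ a b, bilinOfAlternating E (Ω.inChart D y) a b = J a b)
    {g : M → M} {U : Set M} (hg : PreservesOn Ω g U) {x : E} (hx : x ∈ D.target)
    (hxU : D.symm x ∈ U) (hgx : g (D.symm x) ∈ D.source)
    (hgk : ContMDiffAt 𝓘(ℝ, E) 𝓘(ℝ, E) k g (D.symm x)) (a b : E) :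
    J (fderiv ℝ (D ∘ g ∘ D.symm) x a) (fderiv ℝ (D ∘ g ∘ D.symm) x b) = J a b := by
  have hk0 : (k : ℕ∞ω) ≠ 0 := by simp; omega
  have hu : MDifferentiableAt 𝓘(ℝ, E) 𝓘(ℝ, E) (D ∘ g ∘ D.symm) x :=
    (contDiffAt_in_charts hD hD hx hgk hgx).contMDiffAt.mdifferentiableAt hk0
  have hux : (D ∘ g ∘ D.symm) x ∈ D.target := D.map_source hgx
  have hDs : ∀ x ∈ D.target, MDifferentiableAt 𝓘(ℝ, E) 𝓘(ℝ, E) D.symm x := fun x hx =>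
    (contMDiffAt_symm_of_mem_maximalAtlas hD hx).mdifferentiableAt hk0
  have h1 : D.symm ∘ (D ∘ g ∘ D.symm) =ᶠ[𝓝 x] g ∘ D.symm := by
    have h2 : ContinuousAt (g ∘ D.symm) x :=
      (hgk.comp x (contMDiffAt_symm_of_mem_maximalAtlas hD hx)).continuousAt
    exact (h2.eventually (D.open_source.mem_nhds hgx)).mono fun z hz => D.left_inv hz
  have h3 : Ω.pullback (D.symm ∘ (D ∘ g ∘ D.symm)) x = (Ω.inChart D
      ((D ∘ g ∘ D.symm) x)).compContinuousLinearMap (fderiv ℝ (D ∘ g ∘ D.symm) x) := by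
    rw [← mfderiv_eq_fderiv]; exact Ω.pullback_comp (hDs _ hux) hu
  have h4 : Ω.pullback (g ∘ D.symm) x = Ω.inChart D x := by
    rw [Ω.pullback_comp (hgk.mdifferentiableAt hk0) (hDs _ hx)]
    have h5 : Ω.pullback g (D.symm x) = Ω (D.symm x) := hg _ hxU
    rw [h5]; rfl
  rw [Ω.pullback_congr h1, h4] at h3
  rw [← hJ _ hux, ← bilinOfAlternating_comp, ← h3, hJ _ hx]

variable {ι : Type*} {l : Filter ι}

/-- Near a point, symplectic maps that are close to the identity may be cut off to the identity. -/
theorem TwoForm.IsSymplectic.exists_local_extension [FiniteDimensional ℝ E] [T2Space M]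
    [IsManifold 𝓘(ℝ, E) ∞ M] (hΩ : Ω.IsSymplectic) (hk : 1 ≤ k) {U : Set M} (hU : IsOpen U)
    {p : M} (hp : p ∈ U) {F : ι → M → M} (hF : ∀ y ∈ U, MConv E k l F id y)
    (hFs : ∀ᶠ i in l, (∀ y ∈ U, ContMDiffAt 𝓘(ℝ, E) 𝓘(ℝ, E) k (F i) y) ∧
      PreservesOn Ω (F i) U) :
    ∃ W V : Set M, IsOpen W ∧ IsOpen V ∧ p ∈ W ∧ closure W ⊆ V ∧ IsCompact (closure V) ∧
      closure V ⊆ U ∧ ∃ K : ι → Diffeomorph 𝓘(ℝ, E) 𝓘(ℝ, E) M M k,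
        (∀ y, MConv E k l (fun i => K i) id y) ∧
        ∀ᶠ i in l, PreservesOn Ω (K i) Set.univ ∧ Set.EqOn (K i) (F i) W ∧
          Set.EqOn (K i) id Vᶜ := by
  have : IsManifold 𝓘(ℝ, E) k M := IsManifold.of_le (n := ∞) (by exact_mod_cast le_top)
  have : ProperSpace E := FiniteDimensional.proper ℝ E
  obtain ⟨D, hpD, hD1, hD2, J, hJ, hDJ⟩ := hΩ.exists_darboux_chart hk p
  -- The Darboux chart need not be in the smooth atlas, but `MConv` allows all `C^k` charts.
  have hD : D ∈ IsManifold.maximalAtlas 𝓘(ℝ, E) k M := D.mem_maximalAtlas_of_contMDiffOn hD1 hD2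
  set c := D p with hc
  have hnh : ∀ᶠ z in 𝓝 c, z ∈ D.target ∧ D.symm z ∈ U :=
    (D.open_target.eventually_mem (D.map_source hpD)).and
      ((D.tendsto_symm hpD).eventually (hU.eventually_mem hp))
  obtain ⟨R, hR, hRs⟩ := nhds_basis_closedBall.eventually_iff.1 hnh
  have hRt : ∀ r ≤ R, closedBall c r ⊆ D.target := fun r hr x hx =>
    (hRs (closedBall_subset_closedBall hr hx)).1
  have hcpt : ∀ r ≤ R, IsCompact (D.symm '' closedBall c r) := fun r hr =>
    (isCompact_closedBall _ _).image_of_continuousOn (D.continuousOn_symm.mono (hRt r hr))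
  have hopen : ∀ r ≤ R, IsOpen (D.symm '' ball c r) := fun r hr =>
    D.isOpen_image_symm_of_subset_target isOpen_ball (ball_subset_closedBall.trans (hRt r hr))
  have hclos : ∀ r ≤ R, closure (D.symm '' ball c r) ⊆ D.symm '' closedBall c r := fun r hr =>
    closure_minimal (Set.image_mono ball_subset_closedBall) (hcpt r hr).isClosed
  have hsrc : ∀ᶠ i in l, ∀ x ∈ closedBall c R, F i (D.symm x) ∈ D.source := by
    refine (isCompact_closedBall c R).eventually_forall_of_prod_nhds
      (P := fun i x => F i (D.symm x) ∈ D.source) fun x hx => ?_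
    have h1 := (hF _ (hRs hx).2).tendsto.eventually
      (D.open_source.mem_nhds (D.map_target (hRs hx).1))
    have h2 := (tendsto_chart_symm l (D.map_target (hRs hx).1)).eventually h1
    rwa [D.right_inv (hRs hx).1] at h2
  obtain ⟨P, Q, hPc, hPQ⟩ := exists_symplectic_extension (l := l) J hJ hk (c := c) hR
    (u := fun i => D ∘ F i ∘ D.symm) (fun x hx => by
      have hx' := hRs (ball_subset_closedBall hx)
      have h1 := (hF _ hx'.2).ckConv D hD D hD (D.map_target hx'.1) (D.map_target hx'.1)
      rw [D.right_inv hx'.1] at h1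
      exact h1.congr (Eventually.of_forall fun _ => rfl)
        ((D.open_target.eventually_mem hx'.1).mono fun z hz => D.right_inv hz)) (by
      filter_upwards [hFs, hsrc] with i h1 h2 x hx a b
      have hx' := hRs (ball_subset_closedBall hx)
      exact h1.2.fderiv_in_chart hk hD hDJ (J := J) hx'.1 hx'.2
        (h2 x (ball_subset_closedBall hx)) (h1.1 _ hx'.2) a b)
  let good : ι → Prop := fun i => Set.MapsTo (P i) D.target D.target ∧
    ∀ x ∉ closedBall c (R / 2), P i x = x
  let symp : ι → Prop := fun i => Function.LeftInverse (Q i) (P i) ∧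
    Function.RightInverse (Q i) (P i) ∧ ContDiff ℝ k (P i) ∧ ContDiff ℝ k (Q i) ∧
    (∀ x a b, J (fderiv ℝ (P i) x a) (fderiv ℝ (P i) x b) = J a b) ∧
    ∀ x ∉ ball c (R / 2), P i x = x
  have hK : ∀ i, ∃ K : Diffeomorph 𝓘(ℝ, E) 𝓘(ℝ, E) M M k,
      symp i →
      ⇑K = D.transplant (P i) ∧ PreservesOn Ω K Set.univ ∧ good i := by
    intro i
    by_cases h : symp i
    swap
    -- A diffeomorphism is needed at every index; the identity is the default where the extension
    -- fails.
    · exact ⟨Diffeomorph.refl _ _ _, fun h' => absurd h' h⟩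
    obtain ⟨h1, h2, h3, h4, h5, h6⟩ := h
    have hP : ∀ x ∉ closedBall c (R / 2), P i x = x := fun x hx =>
      h6 x fun hx' => hx (ball_subset_closedBall hx')
    have hQ : ∀ x ∉ closedBall c (R / 2), Q i x = x := fun x hx => by
      conv_lhs => rw [← hP x hx]
      exact h1 x
    have hsub := hRt (R / 2) (by linarith)
    have hPt := OpenPartialHomeomorph.mapsTo_target_of_eq_off hsub hP h1.injective
    have hQt := OpenPartialHomeomorph.mapsTo_target_of_eq_off hsub hQ h2.injective
    have hcp := isCompact_closedBall c (R / 2)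
    refine ⟨⟨⟨D.transplant (P i), D.transplant (Q i),
      OpenPartialHomeomorph.transplant_leftInverse h1 hPt,
      OpenPartialHomeomorph.transplant_leftInverse h2 hQt⟩,
      OpenPartialHomeomorph.contMDiff_transplant hD hcp hsub hP hPt h3,
      OpenPartialHomeomorph.contMDiff_transplant hD hcp hsub hQ hQt h4⟩, fun _ => ⟨rfl, ?_,
        hPt, hP⟩⟩
    exact preservesOn_transplant hk hD hDJ (J := J) hcp hsub hP hPt h3 h5
  choose K hK using hK
  have hgood : ∀ᶠ i in l, ⇑(K i) = D.transplant (P i) ∧ PreservesOn Ω (K i) Set.univ ∧ good i ∧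
      ∀ x ∈ ball c (R / 16), P i x = D (F i (D.symm x)) := by
    filter_upwards [hPQ] with i ⟨h1, h2, h3, h4, h5, h6, h7⟩
    obtain ⟨h8, h9, h10⟩ := hK i ⟨h1, h2, h3, h4, h5, h7⟩
    exact ⟨h8, h9, h10, h6⟩
  -- The radius `3 * R / 4` lies strictly between `R / 2`, off which the map is the identity, and
  -- `R`, within which the chart stays inside `U`.
  refine ⟨D.symm '' ball c (R / 16), D.symm '' ball c (3 * R / 4), hopen _ (by linarith),
    hopen _ (by linarith), ⟨c, mem_ball_self (by linarith), D.left_inv hpD⟩,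
    (hclos _ (by linarith)).trans (Set.image_mono (closedBall_subset_ball (by linarith))),
    (hcpt _ (by linarith)).of_isClosed_subset isClosed_closure (hclos _ (by linarith)),
    (hclos _ (by linarith)).trans ?_, K, fun y => ?_, ?_⟩
  · rintro _ ⟨x, hx, rfl⟩
    exact (hRs (closedBall_subset_closedBall (by linarith) hx)).2
  · by_cases hy : y ∈ D.source
    · refine MConv.of_charts hD hD hy hy continuousAt_id ?_ ?_
      · filter_upwards [hgood.prod_inl _, (D.open_source.eventually_mem hy).prod_inr l]
          with q h1 h2
        rw [h1.1, OpenPartialHomeomorph.transplant_of_mem h2]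
        exact D.map_target (h1.2.2.1.1 (D.map_source h2))
      · refine (hPc (D y)).congr ?_ ?_
        · filter_upwards [hgood.prod_inl _,
            (D.open_target.eventually_mem (D.map_source hy)).prod_inr l] with q h1 h2
          have h3 := h1.2.2.1.1 h2
          simp [h1.1, OpenPartialHomeomorph.transplant_of_mem (D.map_target h2), D.right_inv h2,
            D.right_inv h3]
        · exact (D.open_target.eventually_mem (D.map_source hy)).mono fun z hz =>
            (D.right_inv hz).symm
    · have hy' : y ∈ (D.symm '' closedBall c (R / 2))ᶜ := by
        rintro ⟨x, hx, rfl⟩; exact hy (D.map_target (hRt _ (by linarith) hx))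
      refine (MConv.const contMDiffAt_id).congr ?_
      filter_upwards [hgood.prod_inl _, ((hcpt (R / 2)
        (by linarith)).isClosed.isOpen_compl.eventually_mem hy').prod_inr l] with q h1 h2
      rw [h1.1]
      exact (OpenPartialHomeomorph.transplant_of_notMem_image h1.2.2.1.2 h2).symm
  · filter_upwards [hgood, hsrc] with i ⟨h1, h2, h3, h4⟩ h5
    refine ⟨h2, ?_, fun y hy => ?_⟩
    · rintro _ ⟨x, hx, rfl⟩
      have hx' : x ∈ closedBall c R := closedBall_subset_closedBall (by linarith)
        (ball_subset_closedBall hx)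
      have hxt := (hRs hx').1
      rw [h1, OpenPartialHomeomorph.transplant_of_mem (D.map_target hxt), D.right_inv hxt, h4 x hx,
        D.left_inv (h5 x hx')]
    · rw [h1]
      exact OpenPartialHomeomorph.transplant_of_notMem_image h3.2 fun h6 => hy
        (Set.image_mono (closedBall_subset_ball (by linarith)) h6)

/-- Keeps the first cut-off map inside its `V₁`, so that the second one, the identity off the
disjoint `V₂`, does not disturb it. -/
theorem Function.Injective.mapsTo_of_eqOn_id_compl {A : Type*} {K : A → A} {V : Set A}
    (hK : Function.Injective K) (h : Set.EqOn K id Vᶜ) : Set.MapsTo K V V := by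
  intro y hy
  by_contra hn
  have h1 : K (K y) = K y := h hn
  rw [hK h1] at hn
  exact hn hy

/-- Near a finite set, symplectic maps that are close to the identity may be cut off to the
identity. -/
theorem TwoForm.IsSymplectic.exists_extension_finset [FiniteDimensional ℝ E] [T2Space M]
    [IsManifold 𝓘(ℝ, E) ∞ M] (hΩ : Ω.IsSymplectic) (hk : 1 ≤ k) {F : ι → M → M} (S : Finset M) :
    ∀ U : Set M, IsOpen U → (S : Set M) ⊆ U → (∀ y ∈ U, MConv E k l F id y) →
    (∀ᶠ i in l, (∀ y ∈ U, ContMDiffAt 𝓘(ℝ, E) 𝓘(ℝ, E) k (F i) y) ∧ PreservesOn Ω (F i) U) →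
    ∃ W V : Set M, IsOpen W ∧ IsOpen V ∧ (S : Set M) ⊆ W ∧ closure W ⊆ V ∧
      IsCompact (closure V) ∧ closure V ⊆ U ∧
      ∃ K : ι → Diffeomorph 𝓘(ℝ, E) 𝓘(ℝ, E) M M k,
        (∀ y, MConv E k l (fun i => K i) id y) ∧
        ∀ᶠ i in l, PreservesOn Ω (K i) Set.univ ∧ Set.EqOn (K i) (F i) W ∧
          Set.EqOn (K i) id Vᶜ := by
  classical
  have hk0 : (k : ℕ∞ω) ≠ 0 := by simp; omega
  have : IsManifold 𝓘(ℝ, E) k M := IsManifold.of_le (n := ∞) (by exact_mod_cast le_top)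
  induction S using Finset.induction_on with
  | empty =>
    intro U _ _ _ _
    refine ⟨∅, ∅, isOpen_empty, isOpen_empty, by simp, by simp, by simp, by simp,
      fun _ => Diffeomorph.refl _ _ _, fun y => MConv.const contMDiffAt_id,
      Eventually.of_forall fun i => ⟨fun y _ => Ω.pullback_id y, by simp, fun y _ => rfl⟩⟩
  | insert a S ha ih =>
    intro U hU hSU hF hFs
    rw [Finset.coe_insert, Set.insert_subset_iff] at hSU
    obtain ⟨O₁, O₂, hO₁, hO₂, ha₁, hS₂, hdis⟩ := SeparatedNhds.of_singleton_finset ha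
    rw [Set.singleton_subset_iff] at ha₁
    have hsub : ∀ A : Set M, ∀ᶠ i in l, (∀ y ∈ U ∩ A, ContMDiffAt 𝓘(ℝ, E) 𝓘(ℝ, E) k (F i) y) ∧
        PreservesOn Ω (F i) (U ∩ A) := fun A =>
      hFs.mono fun i hi => ⟨fun y hy => hi.1 y hy.1, fun y hy => hi.2 y hy.1⟩
    obtain ⟨W₁, V₁, hW₁, hV₁, haW, hWV₁, hVc₁, hVU₁, K₁, hK₁, hE₁⟩ :=
      hΩ.exists_local_extension hk (hU.inter hO₁) ⟨hSU.1, ha₁⟩ (fun y hy => hF y hy.1) (hsub O₁)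
    obtain ⟨W₂, V₂, hW₂, hV₂, hSW, hWV₂, hVc₂, hVU₂, K₂, hK₂, hE₂⟩ :=
      ih (U ∩ O₂) (hU.inter hO₂) (Set.subset_inter hSU.2 hS₂) (fun y hy => hF y hy.1) (hsub O₂)
    have hV : Disjoint V₁ V₂ := hdis.mono
      (fun y hy => (hVU₁ (subset_closure hy)).2) fun y hy => (hVU₂ (subset_closure hy)).2
    refine ⟨W₁ ∪ W₂, V₁ ∪ V₂, hW₁.union hW₂, hV₁.union hV₂, ?_, ?_, ?_, ?_,
      fun i => (K₁ i).trans (K₂ i), fun y => ?_, ?_⟩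
    · rw [Finset.coe_insert]
      exact Set.insert_subset (Or.inl haW) (hSW.trans Set.subset_union_right)
    · rw [closure_union]; exact Set.union_subset_union hWV₁ hWV₂
    · rw [closure_union]; exact hVc₁.union hVc₂
    · rw [closure_union]
      exact Set.union_subset (hVU₁.trans Set.inter_subset_left) (hVU₂.trans Set.inter_subset_left)
    · exact (hK₂ y).comp (hK₁ y) continuousAt_id
    · filter_upwards [hE₁, hE₂] with i ⟨h1, h2, h3⟩ ⟨h4, h5, h6⟩
      refine ⟨?_, ?_, fun y hy => ?_⟩
      · exact h4.comp h1 (Set.mapsTo_univ _ _)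
          (fun y _ => (K₂ i).contMDiff.contMDiffAt.mdifferentiableAt hk0)
          (fun y _ => (K₁ i).contMDiff.contMDiffAt.mdifferentiableAt hk0)
      · rintro y (hy | hy)
        · have h7 : K₁ i y ∈ V₁ := (K₁ i).injective.mapsTo_of_eqOn_id_compl h3
            (hWV₁ (subset_closure hy))
          have h8 : K₂ i (K₁ i y) = K₁ i y := h6 (hV.subset_compl_right h7)
          exact h8.trans (h2 hy)
        · have h7 : K₁ i y = y := h3 (hV.subset_compl_left (hWV₂ (subset_closure hy)))
          change K₂ i (K₁ i y) = F i y
          rw [h7]; exact h5 hy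
      · have h7 : K₁ i y = y := h3 fun h => hy (Or.inl h)
        change K₂ i (K₁ i y) = y
        rw [h7]; exact h6 fun h => hy (Or.inr h)

end LocalExtension

end

/-! ### The main theorem. -/

theorem mainTheorem12
    {E : Type*} [NormedAddCommGroup E] [NormedSpace ℝ E] [FiniteDimensional ℝ E]
    {M : Type*} [TopologicalSpace M] [T2Space M] [ChartedSpace E M] [IsManifold 𝓘(ℝ, E) ∞ M]
    (Ω : TwoForm E M) (hΩ : Ω.IsSymplectic)
    (k : ℕ) (hk : 1 ≤ k)
    (f : Diffeomorph 𝓘(ℝ, E) 𝓘(ℝ, E) M M k) (hf : PreservesOn Ω f Set.univ)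
    (n : ℕ) (hn : 0 < n) (x : M) (hx : Function.IsPeriodicPt f n x)
    (U : Set M) (hU : IsOpen U) (hxU : ∀ i : ℕ, f^[i] x ∈ U) :
    ∃ W V : Set M, IsOpen W ∧ IsOpen V ∧ (∀ i : ℕ, f^[i] x ∈ W) ∧
      closure W ⊆ V ∧ IsCompact (closure V) ∧ closure V ⊆ U ∧
      ∀ 𝒰 ∈ ckNhds E k f Set.univ, ∃ 𝒢 ∈ ckNhds E k f U, ∀ g ∈ 𝒢,
        IsLocalDiffeomorphOn 𝓘(ℝ, E) 𝓘(ℝ, E) k g U → PreservesOn Ω g U →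
        ∃ h : Diffeomorph 𝓘(ℝ, E) 𝓘(ℝ, E) M M k,
          PreservesOn Ω h Set.univ ∧ ⇑h ∈ 𝒰 ∧ Set.EqOn h g W ∧ Set.EqOn h f Vᶜ := by
  have hk0 : (k : ℕ∞ω) ≠ 0 := by simp; omega
  have : IsManifold 𝓘(ℝ, E) k M := IsManifold.of_le (n := ∞) (by exact_mod_cast le_top)
  classical
  let S : Finset M := (Finset.range n).image fun i => f^[i] x
  have hS : ∀ i : ℕ, f^[i] x ∈ S := fun i =>
    Finset.mem_image.2 ⟨i % n, Finset.mem_range.2 (Nat.mod_lt _ hn), hx.iterate_mod_apply i⟩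
  have hSU : (S : Set M) ⊆ U := by
    intro y hy
    obtain ⟨i, -, rfl⟩ := Finset.mem_image.1 (Finset.mem_coe.1 hy)
    exact hxU i
  -- Convergence of `g` to `f` over `U` among admissible `g`. The sets `W`, `V` and the family `K`
  -- depend on `l` alone, hence not on `𝒰`.
  let l : Filter (M → M) := ckNhds E k f U ⊓
    Filter.principal {g | IsLocalDiffeomorphOn 𝓘(ℝ, E) 𝓘(ℝ, E) k g U ∧ PreservesOn Ω g U}
  have hl : ∀ᶠ g in l, IsLocalDiffeomorphOn 𝓘(ℝ, E) 𝓘(ℝ, E) k g U ∧ PreservesOn Ω g U :=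
    Filter.mem_inf_of_right (Filter.mem_principal_self _)
  have hg : ∀ g : M → M, IsLocalDiffeomorphOn 𝓘(ℝ, E) 𝓘(ℝ, E) k g U →
      ∀ y ∈ U, ContMDiffAt 𝓘(ℝ, E) 𝓘(ℝ, E) k g y := fun g hg y hy =>
    (hg.contMDiffOn y hy).contMDiffAt (hU.mem_nhds hy)
  have hid : (f.symm : M → M) ∘ f = id := funext f.symm_apply_apply
  have hF : ∀ y ∈ U, MConv E k l (fun g => f.symm ∘ g) id y := fun y hy => by
    rw [← hid]
    exact (MConv.const f.symm.contMDiff.contMDiffAt).comp (mConv_of_le_ckNhds hU inf_le_left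
      (fun y _ => f.contMDiff.contMDiffAt) (hl.mono fun g h => hg g h.1) hy)
      f.contMDiff.continuous.continuousAt
  have hFs : ∀ᶠ g in l, (∀ y ∈ U, ContMDiffAt 𝓘(ℝ, E) 𝓘(ℝ, E) k (f.symm ∘ g) y) ∧
      PreservesOn Ω (f.symm ∘ g) U := hl.mono fun g h =>
    ⟨fun y hy => f.symm.contMDiff.contMDiffAt.comp y (hg g h.1 y hy),
      (Diffeomorph.preservesOn_symm hk hf).comp h.2 (Set.mapsTo_univ _ _)
        (fun y _ => f.symm.contMDiff.contMDiffAt.mdifferentiableAt hk0)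
        fun y hy => (hg g h.1 y hy).mdifferentiableAt hk0⟩
  obtain ⟨W, V, hW, hV, hSW, hWV, hVc, hVU, K, hK, hE⟩ :=
    hΩ.exists_extension_finset hk S U hU hSU hF hFs
  refine ⟨W, V, hW, hV, fun i => hSW (hS i), hWV, hVc, hVU, fun 𝒰 h𝒰 => ?_⟩
  have hT : Filter.Tendsto (fun g => (f : M → M) ∘ K g) l (ckNhds E k f Set.univ) :=
    tendsto_ckNhds fun y => (MConv.const (f := f) f.contMDiff.contMDiffAt).comp (hK y)
      continuousAt_id
  -- An eventual property along `l` is a neighbourhood `𝒢` in which every admissible `g` has that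
  -- property.
  refine ⟨_, Filter.mem_inf_principal.1 (Filter.inter_mem hE (hT h𝒰)), fun g h h1 h2 => ?_⟩
  obtain ⟨⟨h3, h4, h5⟩, h6⟩ := h ⟨h1, h2⟩
  refine ⟨(K g).trans f, ?_, h6, fun y hy => ?_, fun y hy => ?_⟩
  · exact hf.comp h3 (Set.mapsTo_univ _ _)
      (fun y _ => f.contMDiff.contMDiffAt.mdifferentiableAt hk0)
      fun y _ => (K g).contMDiff.contMDiffAt.mdifferentiableAt hk0
  · change f (K g y) = g y
    rw [h4 hy]; exact f.apply_symm_apply _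
  · change f (K g y) = f y
    rw [h5 hy]; rfl
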